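/- An instance $I=(G=(V,E),\mathcal C,\omega,\ell,b)$ of \textsc{Stars NWS} consists of a finite simple graph $G$, a collection $\mathcal C$ of vertex sets $C\subseteq V$ (communities), edge weights $\omega:E\to\mathbb R_{\ge 0}$, an integer $\ell$ and a real number $b>0$. For $E'\subseteq E$ and $C\in\mathcal C$, a vertex $x\in C$ is a center of $C$ in $G'=(V,E')$ if $\{x,w\}\in E'$ for all $w\in C\setminus\{x\}$. The graph $G'$ is a solution for $I$ if every community has a center in $G'$, $|E'|\le \ell$ and $\omega(E')=\sum_{e\in E'}\omega(e)\le b$. A minimum solution is a solution $(V,E')$ such that $(V,E'')$ is not a solution for any $E''\subsetneq E'$. (Every solution with the fewest edges among all solutions and, if all weights are positive, every solution of least total weight is a minimum solution in this sense.) A local cycle of a solution $G'$ is a cycle in the union $S_1\cup S_2$, where $S_i$ is the spanning star of $C_i$ with center $c_i$, for two distinct communities $C_1,C_2\in\mathcal C$ and some centers $c_i$ of $C_i$ in $G'$. For $E^*\subseteq E$, a minimum solution $G'=(V,E')$ is fitting for $E^*$ if every edge of every local cycle of $G'$ belongs to $E^*$, and $E^*\subseteq E'$. Theorem. There is an algorithm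 that, given an instance $I=(G=(V,E),\mathcal C,\omega,\ell,b)$ of \textsc{Stars NWS} and a set $E^*\subseteq E$, runs in time polynomial in $|V|+|\mathcal C|$ and either - outputs a solution $G'=(V,E')$ for $I$ with $E^*\subseteq E'$, $|E'|\le\ell$ and $\omega(E')\le b$, or - correctly outputs that no minimum solution is fitting for $E^*$. Here time is counted on a random access machine with two-dimensional arrays of natural numbers and of real numbers, in which every memory access, test and elementary operation takes one step; the operations are addition, truncated subtraction and comparison of natural numbers, and copying, addition and comparison of real numbers (with $0$ as the only real constant). The graph, the communities and $E^*$ are given as 0-1 matrices and the weights as a matrix of real numbers. -/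

import Mathlib

open Polynomial

noncomputable section

namespace StarsNWS

/-! ### Instances, solutions, local cycles -/

/-- An instance `(G, 𝒞, ω, ℓ, b)` of Stars Network Sparsification with vertex set `Fin n`.
The communities are listed as `community 0, …, community (c - 1)`; only the set of the listed
communities matters. Only the values of `weight` on edges of `G` are relevant. -/
structure Instance (n c : ℕ) where
  /-- the input graph -/
  graph : SimpleGraph (Fin n)
  /-- the communities -/
  community : Fin c → Finset (Fin n)
  /-- the edge weights -/
  weight : Sym2 (Fin n) → ℝ
  weight_nonneg : ∀ e ∈ graph.edgeSet, 0 ≤ weight e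
  /-- the bound on the number of edges -/
  ell : ℤ
  /-- the bound on the total weight -/
  b : ℝ
  b_pos : 0 < b

/-- `univ_{(V, E')}(C)`: the vertices of `C` that are adjacent, in the graph with edge set `E'`,
to all other vertices of `C`. -/
def centers {n : ℕ} (E' : Finset (Sym2 (Fin n))) (C : Finset (Fin n)) : Set (Fin n) :=
  {x | x ∈ C ∧ ∀ w ∈ C, w ≠ x → s(x, w) ∈ E'}

/-- The spanning star of `C` with center `x` (vertices outside of `C` are isolated). -/
def spanningStar {n : ℕ} (C : Finset (Fin n)) (x : Fin n) : SimpleGraph (Fin n) :=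
  SimpleGraph.fromEdgeSet {e | ∃ w ∈ C, w ≠ x ∧ e = s(x, w)}

variable {n c : ℕ}

/-- `(V, E')` is a solution of `I`: a spanning subgraph of `G` in which each community has a
center, with at most `ℓ` edges and total weight at most `b`. -/
def Instance.IsSolution (I : Instance n c) (E' : Finset (Sym2 (Fin n))) : Prop :=
  (∀ e ∈ E', e ∈ I.graph.edgeSet) ∧
  (∀ i, (centers E' (I.community i)).Nonempty) ∧
  (E'.card : ℤ) ≤ I.ell ∧
  ∑ e ∈ E', I.weight e ≤ I.b

/-- A solution none of whose edges can be spared: no proper subset of its edge set is a solution.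
A solution with the fewest edges among all solutions is of this kind, and so is, if all edge
weights are positive, a solution of least total weight. -/
def Instance.IsMinimumSolution (I : Instance n c) (E' : Finset (Sym2 (Fin n))) : Prop :=
  I.IsSolution E' ∧ ∀ E'' : Finset (Sym2 (Fin n)), E'' ⊂ E' → ¬ I.IsSolution E''

/-- `L` is the edge set of a local cycle of `(V, E')`: of a cycle in the union of a spanning star
of `C₁` and a spanning star of `C₂`, for two distinct communities `C₁` and `C₂`, where the center
of either star is a center of that community in `(V, E')`. -/
def Instance.IsLocalCycle (I : Instance n c) (E' : Finset (Sym2 (Fin n)))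
    (L : Set (Sym2 (Fin n))) : Prop :=
  ∃ i j, I.community i ≠ I.community j ∧
    ∃ x ∈ centers E' (I.community i), ∃ y ∈ centers E' (I.community j),
      ∃ (v : Fin n) (p : (spanningStar (I.community i) x ⊔
        spanningStar (I.community j) y).Walk v v),
        p.IsCycle ∧ L = {e | e ∈ p.edges}

/-- Each local cycle of `(V, E')` uses only edges of `Es`, and `E'` contains all of `Es`. -/
def Instance.IsFitting (I : Instance n c) (Es E' : Finset (Sym2 (Fin n))) : Prop :=
  (∀ L, I.IsLocalCycle E' L → ∀ e ∈ L, e ∈ Es) ∧ Es ⊆ E'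

/-! ### The machine model

A random access machine with structured control. Its memory consists of two-dimensional arrays of
natural numbers and of two-dimensional arrays of real numbers. A program names finitely many
arrays and computes indices while it runs. On natural numbers it can add, subtract (truncated) and
compare; on real numbers it can only copy, add and compare, and the only real constant is `0`, so
that the bit length of a number grows by at most one with each operation. Each operation, each
memory access and each test takes one step. -/

/-- A memory cell: the number of an array, a row and a column. -/
abbrev Cell := ℕ × ℕ × ℕ

/-- The memory. -/
structure Memory where
  /-- the cells that hold natural numbers -/
  nat : Cell → ℕ
  /-- the cells that hold real numbers -/
  real : Cell → ℝ

/-- Expressions for natural numbers. `cell a i j` reads row `i`, column `j` of array `a`. -/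
inductive NatExpr where
  | const (k : ℕ)
  | cell (a : ℕ) (i j : NatExpr)
  | add (e f : NatExpr)
  | sub (e f : NatExpr)

/-- The value of an expression. -/
def NatExpr.eval (m : Memory) : NatExpr → ℕ
  | const k => k
  | cell a i j => m.nat (a, i.eval m, j.eval m)
  | add e f => e.eval m + f.eval m
  | sub e f => e.eval m - f.eval m

/-- The number of steps that it takes to evaluate an expression. -/
def NatExpr.time : NatExpr → ℕ
  | const _ => 1
  | cell _ i j => i.time + j.time + 1
  | add e f => e.time + f.time + 1
  | sub e f => e.time + f.time + 1

/-- Expressions for real numbers. -/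
inductive RealExpr where
  | zero
  | cell (a : ℕ) (i j : NatExpr)
  | add (e f : RealExpr)

/-- The value of an expression. -/
def RealExpr.eval (m : Memory) : RealExpr → ℝ
  | zero => 0
  | cell a i j => m.real (a, i.eval m, j.eval m)
  | add e f => e.eval m + f.eval m

/-- The number of steps that it takes to evaluate an expression. -/
def RealExpr.time : RealExpr → ℕ
  | zero => 1
  | cell _ i j => i.time + j.time + 1
  | add e f => e.time + f.time + 1

/-- Tests. -/
inductive Test where
  | natLe (e f : NatExpr)
  | realLe (e f : RealExpr)
  | not (t : Test)
  | and (t u : Test)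

/-- Whether a test succeeds. -/
def Test.Holds (m : Memory) : Test → Prop
  | natLe e f => e.eval m ≤ f.eval m
  | realLe e f => e.eval m ≤ f.eval m
  | not t => ¬ t.Holds m
  | and t u => t.Holds m ∧ u.Holds m

/-- The number of steps that a test takes. -/
def Test.time : Test → ℕ
  | natLe e f => e.time + f.time + 1
  | realLe e f => e.time + f.time + 1
  | not t => t.time + 1
  | and t u => t.time + u.time + 1

/-- Programs. `setNat a i j e` and `setReal a i j e` store the value of `e` in row `i`, column `j`
of array `a`. -/
inductive Program where
  | skip
  | setNat (a : ℕ) (i j e : NatExpr)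
  | setReal (a : ℕ) (i j : NatExpr) (e : RealExpr)
  | seq (P Q : Program)
  | branch (t : Test) (P Q : Program)
  | loop (t : Test) (P : Program)

/-- `Runs P m m' k`: started on the memory `m`, the program `P` halts after exactly `k` steps and
leaves the memory `m'`. -/
inductive Runs : Program → Memory → Memory → ℕ → Prop
  | skip (m : Memory) : Runs .skip m m 1
  | setNat (a : ℕ) (i j e : NatExpr) (m : Memory) :
      Runs (.setNat a i j e) m
        { m with nat := Function.update m.nat (a, i.eval m, j.eval m) (e.eval m) }
        (i.time + j.time + e.time + 1)
  | setReal (a : ℕ) (i j : NatExpr) (e : RealExpr) (m : Memory) :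
      Runs (.setReal a i j e) m
        { m with real := Function.update m.real (a, i.eval m, j.eval m) (e.eval m) }
        (i.time + j.time + e.time + 1)
  | seq {P Q : Program} {m₁ m₂ m₃ : Memory} {k l : ℕ} :
      Runs P m₁ m₂ k → Runs Q m₂ m₃ l → Runs (.seq P Q) m₁ m₃ (k + l)
  | branchTrue {t : Test} {P Q : Program} {m m' : Memory} {k : ℕ} :
      t.Holds m → Runs P m m' k → Runs (.branch t P Q) m m' (t.time + k)
  | branchFalse {t : Test} {P Q : Program} {m m' : Memory} {k : ℕ} :
      ¬ t.Holds m → Runs Q m m' k → Runs (.branch t P Q) m m' (t.time + k)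
  | loopFalse {t : Test} {P : Program} {m : Memory} :
      ¬ t.Holds m → Runs (.loop t P) m m t.time
  | loopTrue {t : Test} {P : Program} {m₁ m₂ m₃ : Memory} {k l : ℕ} :
      t.Holds m₁ → Runs P m₁ m₂ k → Runs (.loop t P) m₂ m₃ l →
        Runs (.loop t P) m₁ m₃ (t.time + k + l)

/-! ### Input and output -/

open Classical in
/-- The initial memory for the input `(I, Es)`. The first cells of the natural number arrays
`0, 1, 2, 3` hold `n`, `c`, `max ℓ 0` and `max (-ℓ) 0`; arrays `4`, `5`, `6` hold the 0-1 matrices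
of the graph (vertices by vertices), of the communities (communities by vertices) and of `Es`
(vertices by vertices). The first cell of the real array `0` holds `b`, and the real array `1`
holds the weights of the edges (vertices by vertices). All other cells are `0`. -/
def Instance.input (I : Instance n c) (Es : Finset (Sym2 (Fin n))) : Memory where
  nat := fun
    | (0, 0, 0) => n
    | (1, 0, 0) => c
    | (2, 0, 0) => I.ell.toNat
    | (3, 0, 0) => (-I.ell).toNat
    | (4, i, j) => if ∃ u v : Fin n, i = u ∧ j = v ∧ I.graph.Adj u v then 1 else 0
    | (5, i, j) => if ∃ (k : Fin c) (v : Fin n), i = k ∧ j = v ∧ v ∈ I.community k then 1 else 0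
    | (6, i, j) => if ∃ u v : Fin n, i = u ∧ j = v ∧ s(u, v) ∈ Es then 1 else 0
    | _ => 0
  real := fun
    | (0, 0, 0) => I.b
    | (1, i, j) =>
        if h : i < n ∧ j < n then
          if I.graph.Adj ⟨i, h.1⟩ ⟨j, h.2⟩ then I.weight s(⟨i, h.1⟩, ⟨j, h.2⟩) else 0
        else 0
    | _ => 0

/-- The final memory `m` reports the edge set `E'`: the first cell of the natural number array `0`
holds `1`, and array `1` holds the 0-1 matrix of `E'`. -/
def ReportsEdges (m : Memory) (E' : Finset (Sym2 (Fin n))) : Prop :=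
  m.nat (0, 0, 0) = 1 ∧ ∀ u v : Fin n, m.nat (1, u, v) = if s(u, v) ∈ E' then 1 else 0

/-- The final memory `m` reports failure: the first cell of the natural number array `0` holds
`0`. -/
def ReportsFailure (m : Memory) : Prop :=
  m.nat (0, 0, 0) = 0

end StarsNWS

end

noncomputable section

namespace StarsNWS

variable {n c : ℕ}

/-! ### Fitting solutions -/

section Combinatorics

variable (I : Instance n c) (Es : Finset (Sym2 (Fin n)))

/-! Suppose a fitting minimum solution has centers `y i`. If two distinct communities have different
centers and share two vertices, at least one of which is neither center, then every edge from one of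
the two centers to another common vertex lies on a triangle or a 4-cycle in the union of the two
stars, hence belongs to `Es` (`IsFitting.mem_of_ne`). The only harmless large overlap of stars with
different centers is an intersection that consists of the two centers alone. By minimality, each
edge of `Es` itself lies in some star, so it also restricts the centers of the other communities
that contain it. Together this gives conditions on each center that mention only the input
(`Admissible`), and it forces tied communities to have the same center
(`exists_admissible_centers`).

Group the communities into classes, under the equivalence generated by being tied. A class needs one
common admissible center, and pays only for its star edges outside of `Es`. Three facts make the
classes independent of each other. The number of these edges is the same for all admissible centers
of the class (`ClassAdmissible.card_fresh`). An edge outside of `Es` used by two classes is the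
whole intersection of two linked communities (`mem_sharedEdges_of_mem`). Such shared edges are
selected whatever the admissible centers are (`sharedEdges_subset_selected`), and whether a class
uses one does not depend on its center (`ClassAdmissible.mem_freshEdges_of_shared`). Hence a
cheapest admissible center for each class is optimal for both bounds at once (`sum_selected_le`).
The result costs no more than the stars of a fitting solution, which together with `Es` form a
subset of that solution (`selected_bounds`). If a class has no admissible center, or the selected
edges exceed a bound, then no fitting minimum solution exists.

The program tabulates these notions with counting loops of fixed nesting depth. Apart from the
labels, each result array is written by a single loop nest whose inputs are not changed afterwards,
so all arrays can be described by equations in one final memory (`run_mark`, `run_count`,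
`run_total`). The labels are found by repeated merging (`run_labels`). -/

/-- `w` is incident to an edge of `Es` inside community `i`. -/
def Covered (i : Fin c) (w : Fin n) : Prop :=
  w ∈ I.community i ∧ ∃ u ∈ I.community i, s(u, w) ∈ Es

/-- Communities `i` and `j` share two vertices, one of which is not covered in `i`. -/
def Linked (i j : Fin c) : Prop :=
  ∃ u v, u ≠ v ∧ u ∈ I.community i ∧ u ∈ I.community j ∧ v ∈ I.community i ∧
    v ∈ I.community j ∧ ¬ Covered I Es i v

/-- Communities `i` and `j` share three vertices, one of which is not covered in `i`. -/
def Tied (i j : Fin c) : Prop :=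
  ∃ u v w, u ≠ v ∧ w ≠ u ∧ w ≠ v ∧ u ∈ I.community i ∧ u ∈ I.community j ∧ v ∈ I.community i ∧
    v ∈ I.community j ∧ w ∈ I.community i ∧ w ∈ I.community j ∧ ¬ Covered I Es i v

/-- The vertices that may serve as the center of community `i` in a fitting solution. -/
def Admissible (i : Fin c) (x : Fin n) : Prop :=
  x ∈ I.community i ∧ (∀ w ∈ I.community i, w ≠ x → I.graph.Adj x w) ∧
    (∀ w, Covered I Es i w → w ≠ x → s(x, w) ∈ Es) ∧ ∀ j, Linked I Es i j → x ∈ I.community j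

variable {I Es}

theorem spanningStar_adj {C : Finset (Fin n)} {x w : Fin n} (hw : w ∈ C) (hx : w ≠ x) :
    (spanningStar C x).Adj x w := by
  rw [spanningStar, SimpleGraph.fromEdgeSet_adj]
  exact ⟨⟨w, hw, hx, rfl⟩, hx.symm⟩

/-! ### Cycles forced by two stars with different centers -/

section Fitting

variable {E' : Finset (Sym2 (Fin n))}

/-- If one center lies in the other community, the centers are adjacent in the union of the stars,
and each common vertex `w` closes a triangle with them. -/
theorem Instance.IsFitting.triangle (h : I.IsFitting Es E') {i j : Fin c}
    (hij : I.community i ≠ I.community j) {x y w : Fin n}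
    (hx : x ∈ centers E' (I.community i)) (hy : y ∈ centers E' (I.community j))
    (hxy : x ≠ y) (hwx : w ≠ x) (hwy : w ≠ y)
    (hi : w ∈ I.community i) (hj : w ∈ I.community j)
    (hc : x ∈ I.community j ∨ y ∈ I.community i) :
    s(x, w) ∈ Es ∧ s(y, w) ∈ Es ∧ s(x, y) ∈ Es := by
  set H := spanningStar (I.community i) x ⊔ spanningStar (I.community j) y with hH
  have h1 : H.Adj x w := Or.inl (spanningStar_adj hi hwx)
  have h2 : H.Adj w y := SimpleGraph.Adj.symm (G := H) (Or.inr (spanningStar_adj hj hwy))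
  have h3 : H.Adj y x := by
    rcases hc with hc | hc
    · exact Or.inr (spanningStar_adj hc hxy)
    · exact SimpleGraph.Adj.symm (G := H) (Or.inl (spanningStar_adj hc hxy.symm))
  let p : H.Walk x x := .cons h1 (.cons h2 (.cons h3 .nil))
  have hp : p.IsCycle := by
    simp [p, SimpleGraph.Walk.isCycle_def, SimpleGraph.Walk.isTrail_def, hxy, hxy.symm, hwx, hwy,
      hwx.symm]
  have := h.1 _ ⟨i, j, hij, x, hx, y, hy, x, p, hp, rfl⟩
  refine ⟨this _ (by simp [p]), ?_, ?_⟩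
  · rw [Sym2.eq_swap]; exact this _ (by simp [p])
  · rw [Sym2.eq_swap]; exact this _ (by simp [p])

/-- Two common vertices apart from the centers close the 4-cycle `x w y w'`; no edge between the
centers is needed. -/
theorem Instance.IsFitting.square (h : I.IsFitting Es E') {i j : Fin c}
    (hij : I.community i ≠ I.community j) {x y w w' : Fin n}
    (hx : x ∈ centers E' (I.community i)) (hy : y ∈ centers E' (I.community j))
    (hxy : x ≠ y) (hwx : w ≠ x) (hwy : w ≠ y) (hwx' : w' ≠ x) (hwy' : w' ≠ y) (hww : w ≠ w')
    (hi : w ∈ I.community i) (hj : w ∈ I.community j)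
    (hi' : w' ∈ I.community i) (hj' : w' ∈ I.community j) :
    s(x, w) ∈ Es ∧ s(y, w) ∈ Es := by
  set H := spanningStar (I.community i) x ⊔ spanningStar (I.community j) y with hH
  have h1 : H.Adj x w := Or.inl (spanningStar_adj hi hwx)
  have h2 : H.Adj w y := SimpleGraph.Adj.symm (G := H) (Or.inr (spanningStar_adj hj hwy))
  have h3 : H.Adj y w' := Or.inr (spanningStar_adj hj' hwy')
  have h4 : H.Adj w' x := SimpleGraph.Adj.symm (G := H) (Or.inl (spanningStar_adj hi' hwx'))
  let p : H.Walk x x := .cons h1 (.cons h2 (.cons h3 (.cons h4 .nil)))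
  have hp : p.IsCycle := by
    simp [p, SimpleGraph.Walk.isCycle_def, SimpleGraph.Walk.isTrail_def, hxy, hxy.symm, hwx, hwy,
      hwx.symm, hwx', hwx'.symm, hwy'.symm, hww]
  have := h.1 _ ⟨i, j, hij, x, hx, y, hy, x, p, hp, rfl⟩
  refine ⟨this _ (by simp [p]), ?_⟩
  rw [Sym2.eq_swap]; exact this _ (by simp [p])

/-- Unless two communities share their center, or only the two centers, all edges from the centers
to common vertices belong to `Es`. -/
theorem Instance.IsFitting.mem_of_ne (h : I.IsFitting Es E') {i j : Fin c}
    (hij : I.community i ≠ I.community j) {x y : Fin n}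
    (hx : x ∈ centers E' (I.community i)) (hy : y ∈ centers E' (I.community j)) (hxy : x ≠ y)
    {a b w : Fin n} (hab : a ≠ b) (hai : a ∈ I.community i) (haj : a ∈ I.community j)
    (hbi : b ∈ I.community i) (hbj : b ∈ I.community j)
    {d : Fin n} (hdi : d ∈ I.community i) (hdj : d ∈ I.community j) (hdx : d ≠ x) (hdy : d ≠ y)
    (hwi : w ∈ I.community i) (hwj : w ∈ I.community j) :
    (w ≠ x → s(x, w) ∈ Es) ∧ (w ≠ y → s(y, w) ∈ Es) := by
  by_cases hwx : w = x
  · subst hwx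
    refine ⟨fun h => absurd rfl h, fun _ => ?_⟩
    rw [Sym2.eq_swap]
    exact (h.triangle hij hx hy hxy hdx hdy hdi hdj (.inl hwj)).2.2
  by_cases hwy : w = y
  · subst hwy
    exact ⟨fun _ => (h.triangle hij hx hy hxy hdx hdy hdi hdj (.inr hwi)).2.2,
      fun h => absurd rfl h⟩
  -- One of `a` and `b` differs from `w`. If this second common vertex is a center, it gives a
  -- triangle through `w`, otherwise a 4-cycle.
  obtain ⟨e, hew, hei, hej⟩ : ∃ e, w ≠ e ∧ e ∈ I.community i ∧ e ∈ I.community j := by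
    by_cases hwa : w = a
    · exact ⟨b, hwa ▸ hab, hbi, hbj⟩
    · exact ⟨a, hwa, hai, haj⟩
  by_cases hex : e = x
  · have := h.triangle hij hx hy hxy hwx hwy hwi hwj (.inl (hex ▸ hej))
    exact ⟨fun _ => this.1, fun _ => this.2.1⟩
  by_cases hey : e = y
  · have := h.triangle hij hx hy hxy hwx hwy hwi hwj (.inr (hey ▸ hei))
    exact ⟨fun _ => this.1, fun _ => this.2.1⟩
  have := h.square hij hx hy hxy hwx hwy hex hey hew hwi hwj hei hej
  exact ⟨fun _ => this.1, fun _ => this.2⟩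

/-- In a minimum solution every edge belongs to a star. -/
theorem Instance.IsMinimumSolution.exists_center (h : I.IsMinimumSolution E')
    {e : Sym2 (Fin n)} (he : e ∈ E') :
    ∃ j, ∀ x ∈ centers E' (I.community j), ∃ w ∈ I.community j, w ≠ x ∧ e = s(x, w) := by
  classical
  -- If every community has a center whose star avoids `e`, then `e` can be deleted.
  by_contra! hcon
  refine h.2 (E'.erase e) (Finset.erase_ssubset he) ⟨fun f hf => h.1.1 f (Finset.mem_of_mem_erase hf),
    fun j => ?_, ?_, ?_⟩
  · obtain ⟨x, hx, hxe⟩ := hcon j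
    exact ⟨x, hx.1, fun w hw hwx => Finset.mem_erase.2 ⟨(hxe w hw hwx).symm, hx.2 w hw hwx⟩⟩
  · exact le_trans (by exact_mod_cast Finset.card_erase_le) h.1.2.2.1
  · refine le_trans (Finset.sum_le_sum_of_subset_of_nonneg (Finset.erase_subset _ _) ?_) h.1.2.2.2
    exact fun f hf _ => I.weight_nonneg f (h.1.1 f hf)

/-- A fitting minimum solution has admissible centers, and they agree for tied communities. -/
theorem exists_admissible_centers (hm : I.IsMinimumSolution E') (hf : I.IsFitting Es E') :
    ∃ y : Fin c → Fin n, (∀ i, y i ∈ centers E' (I.community i)) ∧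
      (∀ i, Admissible I Es i (y i)) ∧ ∀ i j, Tied I Es i j → y i = y j := by
  classical
  have hne := hm.1.2.1
  -- Centers are chosen per vertex set, not per index: local cycles only concern distinct
  -- communities, so equal ones have to receive equal centers here.
  let g : Finset (Fin n) → Option (Fin n) := fun C =>
    if h : (centers E' C).Nonempty then some h.choose else none
  have hy : ∀ i, ∃ x ∈ centers E' (I.community i), g (I.community i) = some x := fun i =>
    ⟨(hne i).choose, (hne i).choose_spec, by simp [g, hne i]⟩
  choose y hyc hyg using hy
  have heq : ∀ i j, I.community i = I.community j → y i = y j := fun i j hij => by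
    have := hyg j
    rw [← hij, hyg i] at this
    exact Option.some.inj this
  have key : ∀ i j, y i ≠ y j → ∀ a b d w : Fin n, a ≠ b → a ∈ I.community i → a ∈ I.community j →
      b ∈ I.community i → b ∈ I.community j → d ∈ I.community i → d ∈ I.community j →
      d ≠ y i → d ≠ y j → w ∈ I.community i → w ∈ I.community j →
      (w ≠ y i → s(y i, w) ∈ Es) ∧ (w ≠ y j → s(y j, w) ∈ Es) := by
    intro i j hij a b d w hab h1 h2 h3 h4 h5 h6 h7 h8 h9 h10
    exact hf.mem_of_ne (fun h => hij (heq i j h)) (hyc i) (hyc j) hij hab h1 h2 h3 h4 h5 h6 h7 h8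
      h9 h10
  have hcov : ∀ i j, y i ≠ y j → ∀ a b d w : Fin n, a ≠ b → a ∈ I.community i →
      a ∈ I.community j → b ∈ I.community i → b ∈ I.community j → d ∈ I.community i →
      d ∈ I.community j → d ≠ y i → d ≠ y j → w ∈ I.community i → w ∈ I.community j →
      Covered I Es i w := by
    intro i j hij a b d w hab h1 h2 h3 h4 h5 h6 h7 h8 h9 h10
    have := key i j hij a b d w hab h1 h2 h3 h4 h5 h6 h7 h8 h9 h10
    by_cases hw : w = y i
    · refine ⟨h9, d, h5, ?_⟩
      rw [Sym2.eq_swap, hw]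
      exact (key i j hij a b d d hab h1 h2 h3 h4 h5 h6 h7 h8 h5 h6).1 h7
    · exact ⟨h9, y i, (hyc i).1, this.1 hw⟩
  refine ⟨y, hyc, fun i => ⟨(hyc i).1, ?_, ?_, ?_⟩, ?_⟩
  · intro w hw hwy
    exact (SimpleGraph.mem_edgeSet _).1 (hm.1.1 _ ((hyc i).2 w hw hwy))
  · rintro w ⟨hw, u, hu, huw⟩ hwy
    -- The edge `s(u, w)` of `Es` lies in the star of some community `j`, so one of its ends is `y
    -- j`. Unless `y i` is `u` or `w`, communities `i` and `j` share both ends and have different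
    -- centers, and the end other than `y j` is neither center.
    obtain ⟨j, hj⟩ := hm.exists_center (hf.2 huw)
    obtain ⟨z, hz, hzy, he⟩ := hj _ (hyc j)
    by_cases hui : u = y i
    · rwa [← hui]
    have hcases : (u = y j ∧ w = z) ∨ (u = z ∧ w = y j) := by simpa [Sym2.eq_iff] using he
    have hmem : u ∈ I.community j ∧ w ∈ I.community j ∧ u ≠ w ∧ (u = y j ∨ w = y j) := by
      rcases hcases with ⟨rfl, rfl⟩ | ⟨rfl, rfl⟩
      · exact ⟨(hyc j).1, hz, hzy.symm, .inl rfl⟩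
      · exact ⟨hz, (hyc j).1, hzy, .inr rfl⟩
    obtain ⟨huj, hwj, huw', h4⟩ := hmem
    have hij : y i ≠ y j := by
      rcases h4 with h4 | h4
      · rw [← h4]; exact fun h => hui h.symm
      · rw [← h4]; exact hwy.symm
    rcases h4 with h4 | h4
    · exact (key i j hij u w w w huw' hu huj hw hwj hw hwj hwy (h4 ▸ huw'.symm) hw hwj).1 hwy
    · exact (key i j hij u w u w huw' hu huj hw hwj hu huj hui (h4 ▸ huw') hw hwj).1 hwy
  · rintro j ⟨u, v, huv, hui, huj, hvi, hvj, hv⟩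
    by_contra hyj
    have hij : y i ≠ y j := fun h => hyj (h ▸ (hyc j).1)
    have hu : u ≠ y i := fun h => hyj (h ▸ huj)
    have hv' : v ≠ y i := fun h => hyj (h ▸ hvj)
    refine hv ?_
    by_cases huy : u = y j
    -- Since `y i` is not in community `j`, neither `u` nor `v` is `y i`, and at most one of them is
    -- `y j`; the other one serves as the common vertex that is no center.
    · exact hcov i j hij u v v v huv hui huj hvi hvj hvi hvj hv' (huy ▸ huv.symm) hvi hvj
    · exact hcov i j hij u v u v huv hui huj hvi hvj hui huj hu huy hvi hvj
  · rintro i j ⟨u, v, w, huv, hwu, hwv, hui, huj, hvi, hvj, hwi, hwj, hv⟩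
    by_contra hij
    -- Three common vertices cannot all be among the two centers.
    have hd : ∃ d, d ∈ I.community i ∧ d ∈ I.community j ∧ d ≠ y i ∧ d ≠ y j := by
      by_contra! hcon
      have h1 := hcon u hui huj
      have h2 := hcon v hvi hvj
      have h3 := hcon w hwi hwj
      grind
    obtain ⟨d, h1, h2, h3, h4⟩ := hd
    exact hv (hcov i j hij u v d v huv hui huj hvi hvj h1 h2 h3 h4 hvi hvj)

end Fitting

theorem sum_biUnion_le {α β : Type*} [DecidableEq α] {f : α → ℝ} (hf : ∀ a, 0 ≤ f a)
    (s : Finset β) (t : β → Finset α) :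
    ∑ a ∈ s.biUnion t, f a ≤ ∑ b ∈ s, ∑ a ∈ t b, f a := by
  classical
  induction s using Finset.induction_on with
  | empty => simp
  | insert b s hb ih =>
    rw [Finset.biUnion_insert, Finset.sum_insert hb]
    have := Finset.sum_union_inter (s₁ := t b) (s₂ := s.biUnion t) (f := f)
    have h0 : 0 ≤ ∑ a ∈ t b ∩ s.biUnion t, f a := Finset.sum_nonneg fun a _ => hf a
    linarith

/-! ### Comparing choices of centers class by class -/

section Selection

variable (I Es)
variable {κ : Type*} [DecidableEq κ] (lab : Fin c → κ)

/-- The vertices of the communities with label `l`. -/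
def classUnion (l : κ) : Finset (Fin n) :=
  {w | ∃ i, lab i = l ∧ w ∈ I.community i}

/-- The vertices that the star with center `x` joins to `x` by an edge outside of `Es`. -/
def fresh (l : κ) (x : Fin n) : Finset (Fin n) :=
  {w ∈ classUnion I lab l | w ≠ x ∧ s(x, w) ∉ Es}

/-- The edges outside of `Es` of the star with center `x` on the communities with label `l`. -/
def freshEdges (l : κ) (x : Fin n) : Finset (Sym2 (Fin n)) :=
  (fresh I Es lab l x).image fun w => s(x, w)

/-- `x` may serve as the center of all communities with label `l`. -/
def ClassAdmissible (l : κ) (x : Fin n) : Prop :=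
  ∀ i, lab i = l → Admissible I Es i x

/-- `Es` together with the stars for the chosen centers. -/
def selected (z : κ → Fin n) : Finset (Sym2 (Fin n)) :=
  Es ∪ (Finset.univ.image lab).biUnion fun l => freshEdges I Es lab l (z l)

open Classical in
/-- The edges outside of `Es` that are the whole intersection of two linked communities. -/
def sharedEdges : Finset (Sym2 (Fin n)) :=
  {e | e ∉ Es ∧ ∃ i j, Linked I Es i j ∧ ∀ w, w ∈ e ↔ w ∈ I.community i ∧ w ∈ I.community j}

variable {I Es lab}

theorem mem_fresh {l : κ} {x w : Fin n} :
    w ∈ fresh I Es lab l x ↔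
      (∃ i, lab i = l ∧ w ∈ I.community i) ∧ w ≠ x ∧ s(x, w) ∉ Es := by
  simp [fresh, classUnion]

theorem mem_freshEdges {l : κ} {x : Fin n} {e : Sym2 (Fin n)} :
    e ∈ freshEdges I Es lab l x ↔
      ∃ w i, lab i = l ∧ w ∈ I.community i ∧ w ≠ x ∧ s(x, w) ∉ Es ∧ e = s(x, w) := by
  simp only [freshEdges, Finset.mem_image, mem_fresh]
  constructor
  · rintro ⟨w, ⟨⟨i, h1, h2⟩, h3, h4⟩, rfl⟩
    exact ⟨w, i, h1, h2, h3, h4, rfl⟩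
  · rintro ⟨w, i, h1, h2, h3, h4, rfl⟩
    exact ⟨w, ⟨⟨i, h1, h2⟩, h3, h4⟩, rfl⟩

theorem sum_freshEdges {M : Type*} [AddCommMonoid M] (l : κ) (x : Fin n)
    (f : Sym2 (Fin n) → M) :
    ∑ e ∈ freshEdges I Es lab l x, f e = ∑ w ∈ fresh I Es lab l x, f s(x, w) := by
  rw [freshEdges, Finset.sum_image]
  intro a _ b _ h
  exact Sym2.congr_right.1 h

/-- The end `w` of an edge outside of `Es` at an admissible center `x` cannot be covered in
community `i`, so any community that contains both ends is linked from `i`. -/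
theorem Admissible.linked {i j : Fin c} {x w : Fin n} (h : Admissible I Es i x)
    (hw : w ∈ I.community i) (hx' : x ∈ I.community j) (hw' : w ∈ I.community j) (hwx : w ≠ x)
    (he : s(x, w) ∉ Es) : Linked I Es i j :=
  ⟨x, w, hwx.symm, h.1, hx', hw, hw', fun hc => he (h.2.2.1 w hc hwx)⟩

/-- If `s(y, w)` were in `Es`, then `w` would be covered in a community of the class, and
admissibility of `x` would put `s(x, w)` into `Es` too. -/
theorem ClassAdmissible.mem_fresh_of_mem {l : κ} {x y w : Fin n}
    (hx : ClassAdmissible I Es lab l x) (hy : ClassAdmissible I Es lab l y) (hwy : w ≠ y)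
    (hw : w ∈ fresh I Es lab l x) : w ∈ fresh I Es lab l y := by
  obtain ⟨⟨i, hi, hwi⟩, hwx, he⟩ := mem_fresh.1 hw
  refine mem_fresh.2 ⟨⟨i, hi, hwi⟩, hwy, fun h => he ?_⟩
  exact (hx i hi).2.2.1 w ⟨hwi, y, (hy i hi).1, h⟩ hwx

theorem ClassAdmissible.mem_fresh_self {l : κ} {x y : Fin n}
    (hx : ClassAdmissible I Es lab l x) (h : y ∈ fresh I Es lab l x) :
    x ∈ fresh I Es lab l y := by
  obtain ⟨⟨i, hi, -⟩, hyx, he⟩ := mem_fresh.1 h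
  exact mem_fresh.2 ⟨⟨i, hi, (hx i hi).1⟩, hyx.symm, by rwa [Sym2.eq_swap]⟩

/-- The number of edges that a class of communities needs does not depend on the center. -/
theorem ClassAdmissible.card_fresh {l : κ} {x y : Fin n}
    (hx : ClassAdmissible I Es lab l x) (hy : ClassAdmissible I Es lab l y) :
    (fresh I Es lab l x).card = (fresh I Es lab l y).card := by
  by_cases hxy : x = y
  · rw [hxy]
  -- Apart from `x` and `y` the two fresh sets coincide, and `y` is fresh for `x` exactly if `x` is
  -- fresh for `y`.
  have herase : (fresh I Es lab l x).erase y = (fresh I Es lab l y).erase x := by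
    ext w
    simp only [Finset.mem_erase]
    constructor
    · rintro ⟨h1, h2⟩
      exact ⟨(mem_fresh.1 h2).2.1, hx.mem_fresh_of_mem hy h1 h2⟩
    · rintro ⟨h1, h2⟩
      exact ⟨(mem_fresh.1 h2).2.1, hy.mem_fresh_of_mem hx h1 h2⟩
  by_cases h : y ∈ fresh I Es lab l x
  · rw [← Finset.card_erase_add_one h, ← Finset.card_erase_add_one (hx.mem_fresh_self h), herase]
  · rw [← Finset.erase_eq_of_notMem h, herase,
      Finset.erase_eq_of_notMem fun h' => h (hy.mem_fresh_self h')]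

/-- Let the shared edge be the intersection of communities `a` and `b`. Both ends lie in `a`, in `b`
and in a community of the class, so that community is linked to `a` and `b`. Admissibility then puts
`y` into both, so `y` is an end of the edge. -/
theorem ClassAdmissible.mem_freshEdges_of_shared {l : κ} {x y : Fin n}
    (hx : ClassAdmissible I Es lab l x) (hy : ClassAdmissible I Es lab l y)
    {e : Sym2 (Fin n)} (he : e ∈ freshEdges I Es lab l x) (hs : e ∈ sharedEdges I Es) :
    e ∈ freshEdges I Es lab l y := by
  by_cases hxy : x = y
  · rwa [← hxy]
  obtain ⟨w, i, hi, hw, hwx, hE, rfl⟩ := mem_freshEdges.1 he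
  simp only [sharedEdges, Finset.mem_filter, Finset.mem_univ, true_and] at hs
  obtain ⟨-, a, b, -, hab⟩ := hs
  have h1 := (hab x).1 (by simp)
  have h2 := (hab w).1 (by simp)
  have hya := (hy i hi).2.2.2 a ((hx i hi).linked hw h1.1 h2.1 hwx hE)
  have hyb := (hy i hi).2.2.2 b ((hx i hi).linked hw h1.2 h2.2 hwx hE)
  have hyw : y = w := by
    have := (hab y).2 ⟨hya, hyb⟩
    rw [Sym2.mem_iff] at this
    exact this.resolve_left (Ne.symm hxy)
  subst hyw
  exact mem_freshEdges.2 ⟨x, i, hi, (hx i hi).1, hxy, by rwa [Sym2.eq_swap], Sym2.eq_swap⟩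

/-- The shared edges in the two stars are the same, so they cancel from the comparison. -/
theorem sum_freshEdges_sdiff_le {l : κ} {x y : Fin n}
    (hx : ClassAdmissible I Es lab l x) (hy : ClassAdmissible I Es lab l y)
    {f : Sym2 (Fin n) → ℝ}
    (h : ∑ w ∈ fresh I Es lab l x, f s(x, w) ≤ ∑ w ∈ fresh I Es lab l y, f s(y, w)) :
    ∑ e ∈ freshEdges I Es lab l x \ sharedEdges I Es, f e ≤
      ∑ e ∈ freshEdges I Es lab l y \ sharedEdges I Es, f e := by
  have hinter : freshEdges I Es lab l x ∩ sharedEdges I Es =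
      freshEdges I Es lab l y ∩ sharedEdges I Es := by
    ext e
    simp only [Finset.mem_inter]
    exact ⟨fun he => ⟨hx.mem_freshEdges_of_shared hy he.1 he.2, he.2⟩,
      fun he => ⟨hy.mem_freshEdges_of_shared hx he.1 he.2, he.2⟩⟩
  have h1 := Finset.sum_inter_add_sum_sdiff (freshEdges I Es lab l x) (sharedEdges I Es) f
  have h2 := Finset.sum_inter_add_sum_sdiff (freshEdges I Es lab l y) (sharedEdges I Es) f
  rw [sum_freshEdges] at h1 h2
  rw [hinter] at h1
  linarith

/-- For linked communities `i` and `j`, the center chosen for `i` also lies in `j`. If the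
intersection is an edge, the center is one of its ends, and its star contains the edge. -/
theorem sharedEdges_subset_selected {z : κ → Fin n}
    (hz : ∀ i, Admissible I Es i (z (lab i))) :
    sharedEdges I Es ⊆ selected I Es lab z := by
  intro e he
  simp only [sharedEdges, Finset.mem_filter, Finset.mem_univ, true_and] at he
  obtain ⟨heE, i, j, hij, he⟩ := he
  have hze : z (lab i) ∈ e := (he _).2 ⟨(hz i).1, (hz i).2.2.2 j hij⟩
  obtain ⟨w, rfl⟩ := Sym2.mem_iff_exists.1 hze
  have hw := (he w).1 (by simp)
  -- Linked communities share two different vertices, so `e` is not a loop.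
  have hwz : w ≠ z (lab i) := by
    obtain ⟨u, v, huv, h1, h2, h3, h4, -⟩ := hij
    have h5 := (he u).2 ⟨h1, h2⟩
    have h6 := (he v).2 ⟨h3, h4⟩
    rw [Sym2.mem_iff] at h5 h6
    grind
  refine Finset.mem_union_right _ (Finset.mem_biUnion.2 ⟨lab i, by simp, ?_⟩)
  exact mem_freshEdges.2 ⟨w, i, rfl, hw.1, hwz, heE, rfl⟩

/-- An edge used by both classes links a community of the first to one of the second. A third common
vertex would make the two communities tied, hence equally labelled. -/
theorem mem_sharedEdges_of_mem {z : κ → Fin n} (hz : ∀ i, Admissible I Es i (z (lab i)))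
    (hlab : ∀ i j, Tied I Es i j → lab i = lab j) {l l' : κ} (hl : l ≠ l') {e : Sym2 (Fin n)}
    (he : e ∈ freshEdges I Es lab l (z l)) (he' : e ∈ freshEdges I Es lab l' (z l')) :
    e ∈ sharedEdges I Es := by
  obtain ⟨w, i, rfl, hw, hwx, hE, rfl⟩ := mem_freshEdges.1 he
  obtain ⟨w', j, rfl, hw', hwx', hE', he⟩ := mem_freshEdges.1 he'
  have hmem : ∀ v ∈ s(z (lab i), w), v ∈ I.community j := by
    intro v hv
    rw [he, Sym2.mem_iff] at hv
    rcases hv with rfl | rfl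
    · exact (hz j).1
    · exact hw'
  have hx := hmem (z (lab i)) (by simp)
  have hwj := hmem w (by simp)
  simp only [sharedEdges, Finset.mem_filter, Finset.mem_univ, true_and]
  refine ⟨hE, i, j, (hz i).linked hw hx hwj hwx hE, fun v => ⟨fun hv => ⟨?_, hmem v hv⟩, ?_⟩⟩
  · rw [Sym2.mem_iff] at hv
    rcases hv with rfl | rfl
    · exact (hz i).1
    · exact hw
  · rintro ⟨h1, h2⟩
    by_contra hv
    rw [Sym2.mem_iff, not_or] at hv
    refine hl (hlab i j ⟨z (lab i), w, v, hwx.symm, hv.1, hv.2, (hz i).1, hx, hw, hwj, h1, h2, ?_⟩)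
    exact fun hc => hE ((hz i).2.2.1 w hc hwx)

/-- Centers that are at least as good for each class of communities are at least as good. -/
theorem sum_selected_le {x y : κ → Fin n} (hx : ∀ l, ClassAdmissible I Es lab l (x l))
    (hy : ∀ l, ClassAdmissible I Es lab l (y l))
    (hlab : ∀ i j, Tied I Es i j → lab i = lab j) {f : Sym2 (Fin n) → ℝ} (hf : ∀ e, 0 ≤ f e)
    (h : ∀ l, ∑ w ∈ fresh I Es lab l (x l), f s(x l, w) ≤
      ∑ w ∈ fresh I Es lab l (y l), f s(y l, w)) :
    ∑ e ∈ selected I Es lab x, f e ≤ ∑ e ∈ selected I Es lab y, f e := by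
  set U := sharedEdges I Es with hU
  set L := Finset.univ.image lab with hL
  -- For `x` only an upper bound is needed, so overlaps between classes may be counted repeatedly.
  -- For `y` the parts are disjoint (`hdisj`, `hpair`), so their sum is exact.
  have hsub : selected I Es lab x ⊆
      (Es ∪ U) ∪ L.biUnion fun l => freshEdges I Es lab l (x l) \ U := by
    intro e he
    simp only [selected, Finset.mem_union, Finset.mem_biUnion, Finset.mem_sdiff] at he ⊢
    by_cases heU : e ∈ U
    · exact .inl (.inr heU)
    · rcases he with he | ⟨l, h1, h2⟩
      · exact .inl (.inl he)
      · exact .inr ⟨l, h1, h2, heU⟩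
  have hsup : (Es ∪ U) ∪ L.biUnion (fun l => freshEdges I Es lab l (y l) \ U) ⊆
      selected I Es lab y := by
    refine Finset.union_subset (Finset.union_subset Finset.subset_union_left
      (sharedEdges_subset_selected fun i => hy _ i rfl)) (Finset.Subset.trans ?_
        Finset.subset_union_right)
    exact Finset.biUnion_mono fun l _ => Finset.sdiff_subset
  have hdisj : Disjoint (Es ∪ U) (L.biUnion fun l => freshEdges I Es lab l (y l) \ U) := by
    rw [Finset.disjoint_left]
    intro e he he'
    simp only [Finset.mem_union, Finset.mem_biUnion, Finset.mem_sdiff] at he he'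
    obtain ⟨l, -, h1, h2⟩ := he'
    obtain ⟨w, i, -, -, -, hE, rfl⟩ := mem_freshEdges.1 h1
    exact he.elim hE h2
  have hpair : (L : Set κ).PairwiseDisjoint fun l => freshEdges I Es lab l (y l) \ U := by
    intro l _ l' _ hl
    rw [Function.onFun, Finset.disjoint_left]
    intro e he he'
    rw [Finset.mem_sdiff] at he he'
    exact he.2 (mem_sharedEdges_of_mem (fun i => hy _ i rfl) hlab hl he.1 he'.1)
  calc ∑ e ∈ selected I Es lab x, f e
      ≤ ∑ e ∈ (Es ∪ U) ∪ L.biUnion (fun l => freshEdges I Es lab l (x l) \ U), f e :=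
        Finset.sum_le_sum_of_subset_of_nonneg hsub fun e _ _ => hf e
    _ ≤ ∑ e ∈ Es ∪ U, f e + ∑ e ∈ L.biUnion (fun l => freshEdges I Es lab l (x l) \ U), f e := by
        rw [← Finset.sum_union_inter]
        exact le_add_of_nonneg_right (Finset.sum_nonneg fun e _ => hf e)
    _ ≤ ∑ e ∈ Es ∪ U, f e + ∑ l ∈ L, ∑ e ∈ freshEdges I Es lab l (x l) \ U, f e := by
        gcongr
        exact sum_biUnion_le hf _ _
    _ ≤ ∑ e ∈ Es ∪ U, f e + ∑ l ∈ L, ∑ e ∈ freshEdges I Es lab l (y l) \ U, f e := by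
        have := Finset.sum_le_sum fun l (_ : l ∈ L) =>
          sum_freshEdges_sdiff_le (hx l) (hy l) (h l)
        linarith
    _ = ∑ e ∈ (Es ∪ U) ∪ L.biUnion (fun l => freshEdges I Es lab l (y l) \ U), f e := by
        rw [Finset.sum_union hdisj, Finset.sum_biUnion hpair]
    _ ≤ ∑ e ∈ selected I Es lab y, f e :=
        Finset.sum_le_sum_of_subset_of_nonneg hsup fun e _ _ => hf e

variable (I) in
open Classical in
/-- The weight of an edge of the graph, and `0` for other pairs of vertices. -/
def edgeWeight (e : Sym2 (Fin n)) : ℝ :=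
  if e ∈ I.graph.edgeSet then I.weight e else 0

theorem edgeWeight_nonneg (e : Sym2 (Fin n)) : 0 ≤ edgeWeight I e := by
  rw [edgeWeight]
  split_ifs with h
  · exact I.weight_nonneg e h
  · exact le_rfl

theorem sum_edgeWeight {E : Finset (Sym2 (Fin n))} (h : ∀ e ∈ E, e ∈ I.graph.edgeSet) :
    ∑ e ∈ E, edgeWeight I e = ∑ e ∈ E, I.weight e :=
  Finset.sum_congr rfl fun e he => if_pos (h e he)

theorem mem_edgeSet_of_mem_selected (hEs : ∀ e ∈ Es, e ∈ I.graph.edgeSet) {z : κ → Fin n}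
    (hz : ∀ i, Admissible I Es i (z (lab i))) {e : Sym2 (Fin n)}
    (he : e ∈ selected I Es lab z) : e ∈ I.graph.edgeSet := by
  rw [selected, Finset.mem_union, Finset.mem_biUnion] at he
  obtain he | ⟨l, -, he⟩ := he
  · exact hEs e he
  · obtain ⟨w, i, rfl, hw, hwx, -, rfl⟩ := mem_freshEdges.1 he
    exact (hz i).2.1 w hw hwx

theorem mem_centers_selected {z : κ → Fin n} (hz : ∀ i, Admissible I Es i (z (lab i)))
    (i : Fin c) : z (lab i) ∈ centers (selected I Es lab z) (I.community i) := by
  refine ⟨(hz i).1, fun w hw hwx => ?_⟩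
  rw [selected, Finset.mem_union, Finset.mem_biUnion]
  by_cases he : s(z (lab i), w) ∈ Es
  · exact .inl he
  · exact .inr ⟨lab i, by simp, mem_freshEdges.2 ⟨w, i, rfl, hw, hwx, he, rfl⟩⟩

/-- Labels that are equal for tied communities, and only if they have to be, admit centers with
which the selected edges are part of a given fitting solution. -/
theorem exists_selected_subset {lab : Fin c → Fin c} {E' : Finset (Sym2 (Fin n))}
    (hm : I.IsMinimumSolution E') (hf : I.IsFitting Es E')
    (hsound : ∀ g : Fin c → Fin n, (∀ i j, Tied I Es i j → g i = g j) →
      ∀ i j, lab i = lab j → g i = g j) :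
    ∃ y : Fin c → Fin n, (∀ l, ClassAdmissible I Es lab l (y l)) ∧
      selected I Es lab y ⊆ E' := by
  classical
  obtain ⟨y, hyc, hya, hyt⟩ := exists_admissible_centers hm hf
  -- A label that does not occur imposes no condition; `y l` is an arbitrary default for it.
  let y' : Fin c → Fin n := fun l => if h : ∃ i, lab i = l then y h.choose else y l
  have hy' : ∀ i, y' (lab i) = y i := by
    intro i
    have h : ∃ j, lab j = lab i := ⟨i, rfl⟩
    rw [show y' (lab i) = y h.choose from dif_pos h]
    exact hsound y hyt _ _ h.choose_spec
  refine ⟨y', ?_, ?_⟩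
  · rintro _ i rfl
    rw [hy']
    exact hya i
  · intro e he
    rw [selected, Finset.mem_union, Finset.mem_biUnion] at he
    obtain he | ⟨l, -, he⟩ := he
    · exact hf.2 he
    · obtain ⟨w, i, rfl, hw, hwx, -, rfl⟩ := mem_freshEdges.1 he
      rw [hy'] at hwx ⊢
      exact (hyc i).2 w hw hwx

/-- Admissible centers of least weight yield a solution if there is a fitting solution. -/
theorem selected_bounds {lab : Fin c → Fin c} {E' : Finset (Sym2 (Fin n))}
    (hEs : ∀ e ∈ Es, e ∈ I.graph.edgeSet)
    (hm : I.IsMinimumSolution E') (hf : I.IsFitting Es E')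
    (hlab : ∀ i j, Tied I Es i j → lab i = lab j)
    (hsound : ∀ g : Fin c → Fin n, (∀ i j, Tied I Es i j → g i = g j) →
      ∀ i j, lab i = lab j → g i = g j)
    {z : Fin c → Fin n} (hz : ∀ l, ClassAdmissible I Es lab l (z l))
    (hmin : ∀ l y, ClassAdmissible I Es lab l y →
      ∑ w ∈ fresh I Es lab l (z l), edgeWeight I s(z l, w) ≤
        ∑ w ∈ fresh I Es lab l y, edgeWeight I s(y, w)) :
    ((selected I Es lab z).card : ℤ) ≤ I.ell ∧ ∑ e ∈ selected I Es lab z, I.weight e ≤ I.b := by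
  obtain ⟨y, hy, hsub⟩ := exists_selected_subset hm hf hsound
  constructor
  -- With constant weight `1` the comparison counts edges, and all admissible centers of a class
  -- tie.
  · have h := sum_selected_le (f := fun _ => 1) hz hy hlab (fun _ => zero_le_one) fun l => by
      simp [(hz l).card_fresh (hy l)]
    have h' : (selected I Es lab z).card ≤ (selected I Es lab y).card := by
      simpa using h
    exact le_trans (by exact_mod_cast h'.trans (Finset.card_le_card hsub)) hm.1.2.2.1
  · rw [← sum_edgeWeight fun e he => mem_edgeSet_of_mem_selected hEs (fun i => hz _ i rfl) he]
    refine (sum_selected_le hz hy hlab edgeWeight_nonneg fun l => hmin l _ (hy l)).trans ?_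
    refine (Finset.sum_le_sum_of_subset_of_nonneg hsub fun e _ _ => edgeWeight_nonneg e).trans ?_
    rw [sum_edgeWeight hm.1.1]
    exact hm.1.2.2.2

end Selection

end Combinatorics

/-! ### Counting loops -/

/-- Whether the array number `a` is reserved for loop counters. -/
def isCounter (a : ℕ) : Bool := decide (10 ≤ a) && decide (a < 20)

/-- The arrays whose first cells hold the number of vertices and the number of communities. -/
def sizeArray (b : Bool) : ℕ := if b then 30 else 0

/-- Store `v` in the first cell of the natural number array `k`. -/
def Memory.upd (m : Memory) (k v : ℕ) : Memory :=
  { m with nat := Function.update m.nat (k, 0, 0) v }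

/-- The first cell of an array. -/
abbrev NatExpr.var (k : ℕ) : NatExpr := .cell k (.const 0) (.const 0)

/-- Programs whose loops are counting loops. `loop k b C` runs `C` with the counter `k` running
through all numbers below the number of vertices (`b = false`) or communities (`b = true`). -/
inductive Command where
  | skip
  | set (a : ℕ) (i j e : NatExpr)
  | setReal (a : ℕ) (i j : NatExpr) (e : RealExpr)
  | seq (C D : Command)
  | cond (t : Test) (C : Command)
  | loop (k : ℕ) (b : Bool) (C : Command)

namespace Command

/-- The program for a command. -/
def compile : Command → Program
  | skip => .skip
  | set a i j e => .setNat a i j e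
  | setReal a i j e => .setReal a i j e
  | seq C D => .seq C.compile D.compile
  | cond t C => .branch t C.compile .skip
  | loop k b C => .seq (.setNat k (.const 0) (.const 0) (.const 0))
      (.loop (.not (.natLe (.var (sizeArray b)) (.var k)))
        (.seq C.compile (.setNat k (.const 0) (.const 0) (.add (.var k) (.const 1)))))

open Classical in
/-- The memory after a command. -/
def run : Command → Memory → Memory
  | skip => fun m => m
  | set a i j e => fun m =>
      { m with nat := Function.update m.nat (a, i.eval m, j.eval m) (e.eval m) }
  | setReal a i j e => fun m =>
      { m with real := Function.update m.real (a, i.eval m, j.eval m) (e.eval m) }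
  | seq C D => fun m => D.run (C.run m)
  | cond t C => fun m => if t.Holds m then C.run m else m
  | loop k b C => fun m =>
      Nat.rec (m.upd k 0) (fun v m' => (C.run m').upd k (v + 1)) (m.nat (sizeArray b, 0, 0))

/-- The arrays that a command writes, except for its counters. -/
def targets : Command → List ℕ
  | skip => []
  | set a _ _ _ => [a]
  | setReal a _ _ _ => [a]
  | seq C D => C.targets ++ D.targets
  | cond _ C => C.targets
  | loop _ _ C => C.targets

/-- The counters of a command. -/
def counters : Command → List ℕ
  | skip => []
  | set _ _ _ _ => []
  | setReal _ _ _ _ => []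
  | seq C D => C.counters ++ D.counters
  | cond _ C => C.counters
  | loop k _ C => k :: C.counters

/-- Loops use counter arrays and do not interfere with each other or with the sizes. -/
def wf : Command → Bool
  | skip => true
  | set a _ _ _ => !isCounter a && a != 0 && a != 30
  | setReal a _ _ _ => !isCounter a && a != 0 && a != 30
  | seq C D => C.wf && D.wf
  | cond _ C => C.wf
  | loop k _ C => isCounter k && !C.counters.contains k && C.wf

/-- A bound for the number of steps. -/
def cost : Command → ℕ[X]
  | skip => 1
  | set _ i j e => C (i.time + j.time + e.time + 1)
  | setReal _ i j e => C (i.time + j.time + e.time + 1)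
  | seq D D' => D.cost + D'.cost
  | cond t D => C (t.time + 1) + D.cost
  | loop _ _ D => 12 + X * (D.cost + 16)

end Command

@[simp] theorem Memory.upd_nat (m : Memory) (k v a i j : ℕ) :
    (m.upd k v).nat (a, i, j) = if a = k ∧ i = 0 ∧ j = 0 then v else m.nat (a, i, j) := by
  simp [Memory.upd, Function.update_apply]

@[simp] theorem Memory.upd_real (m : Memory) (k v : ℕ) : (m.upd k v).real = m.real := rfl

namespace Command

theorem isCounter_of_mem_counters {C : Command} (h : C.wf) {k : ℕ} (hk : k ∈ C.counters) :
    isCounter k := by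
  induction C <;> simp_all [wf, counters]
  all_goals grind

theorem not_isCounter_of_mem_targets {C : Command} (h : C.wf) {a : ℕ} (ha : a ∈ C.targets) :
    isCounter a = false ∧ a ≠ 0 ∧ a ≠ 30 := by
  induction C with
  | seq C D ihC ihD =>
    simp only [wf, Bool.and_eq_true, targets, List.mem_append] at h ha
    exact ha.elim (ihC h.1) (ihD h.2)
  | loop k b C ih =>
    simp only [wf, Bool.and_eq_true] at h
    exact ih h.2 ha
  | cond t C ih => exact ih h ha
  | _ => simp_all [wf, targets]

theorem sizeArray_notMem_targets {C : Command} (h : C.wf) (b : Bool) :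
    sizeArray b ∉ C.targets := by
  intro hb
  have := not_isCounter_of_mem_targets h hb
  cases b <;> simp_all [sizeArray]

theorem sizeArray_notMem_counters {C : Command} (h : C.wf) (b : Bool) :
    sizeArray b ∉ C.counters := by
  intro hb
  have := isCounter_of_mem_counters h hb
  cases b <;> simp_all [sizeArray, isCounter]

/-- Both parts of the memory are framed together by array number, so natural and real arrays with
the same number share one write permission. -/
theorem run_frame (C : Command) (m : Memory) {a : ℕ} (ht : a ∉ C.targets)
    (hc : a ∉ C.counters) (i j : ℕ) :
    (C.run m).nat (a, i, j) = m.nat (a, i, j) ∧ (C.run m).real (a, i, j) = m.real (a, i, j) := by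
  induction C generalizing m with
  | skip => exact ⟨rfl, rfl⟩
  | set b i j e =>
    simp only [targets, List.mem_singleton] at ht
    simp [run, ht]
  | setReal b i j e =>
    simp only [targets, List.mem_singleton] at ht
    simp [run, ht]
  | seq C D ihC ihD =>
    simp only [targets, counters, List.mem_append, not_or] at ht hc
    have h1 := ihC m ht.1 hc.1
    have h2 := ihD (C.run m) ht.2 hc.2
    exact ⟨h2.1.trans h1.1, h2.2.trans h1.2⟩
  | cond t C ih =>
    simp only [run]
    split_ifs
    · exact ih m ht hc
    · exact ⟨rfl, rfl⟩
  | loop k b C ih =>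
    simp only [counters, List.mem_cons, not_or] at hc
    simp only [run]
    induction m.nat (sizeArray b, 0, 0) with
    | zero => simp [hc.1]
    | succ v ihv =>
      simp only [Memory.upd_nat, Memory.upd_real, hc.1, false_and, if_false]
      exact ⟨(ih _ ht hc.2).1.trans ihv.1, (ih _ ht hc.2).2.trans ihv.2⟩

theorem run_size {C : Command} (h : C.wf) (m : Memory) (b : Bool) :
    (C.run m).nat (sizeArray b, 0, 0) = m.nat (sizeArray b, 0, 0) :=
  (run_frame C m (sizeArray_notMem_targets h b) (sizeArray_notMem_counters h b) 0 0).1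

/-- The memory after `v` rounds of a counting loop. -/
def rounds (k : ℕ) (C : Command) (m : Memory) (v : ℕ) : Memory :=
  Nat.rec (m.upd k 0) (fun v m' => (C.run m').upd k (v + 1)) v

theorem rounds_succ (k : ℕ) (C : Command) (m : Memory) (v : ℕ) :
    rounds k C m (v + 1) = (C.run (rounds k C m v)).upd k (v + 1) := rfl

theorem rounds_counter (k : ℕ) (C : Command) (m : Memory) (v : ℕ) :
    (rounds k C m v).nat (k, 0, 0) = v := by
  cases v <;> simp [rounds]

theorem rounds_frame (k : ℕ) (C : Command) (m : Memory) {a : ℕ} (ht : a ∉ C.targets)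
    (hc : a ∉ C.counters) (hk : a ≠ k) (v i j : ℕ) :
    (rounds k C m v).nat (a, i, j) = m.nat (a, i, j) ∧
      (rounds k C m v).real (a, i, j) = m.real (a, i, j) := by
  induction v with
  | zero => simp [rounds, hk]
  | succ v ih =>
    have := run_frame C (rounds k C m v) ht hc i j
    rw [rounds_succ]
    simp [hk, this, ih]

theorem rounds_size {k : ℕ} {C : Command} (h : C.wf) (hk : isCounter k) (m : Memory) (v : ℕ)
    (b : Bool) : (rounds k C m v).nat (sizeArray b, 0, 0) = m.nat (sizeArray b, 0, 0) := by
  refine (rounds_frame k C m (sizeArray_notMem_targets h b) (sizeArray_notMem_counters h b) ?_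
    v 0 0).1
  rintro rfl
  cases b <;> simp [sizeArray, isCounter] at hk

/-- The program for a command computes `run` in polynomial time. -/
theorem exists_runs_compile {C : Command} (h : C.wf) {s : ℕ} (m : Memory)
    (hs : ∀ b, m.nat (sizeArray b, 0, 0) ≤ s) :
    ∃ t, Runs C.compile m (C.run m) t ∧ t ≤ C.cost.eval s := by
  induction C generalizing m with
  | skip => exact ⟨_, .skip m, by simp [cost]⟩
  | set a i j e => exact ⟨_, .setNat a i j e m, by simp [cost]⟩
  | setReal a i j e => exact ⟨_, .setReal a i j e m, by simp [cost]⟩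
  | seq C D ihC ihD =>
    simp only [wf, Bool.and_eq_true] at h
    obtain ⟨t, ht, htc⟩ := ihC h.1 m hs
    obtain ⟨t', ht', htc'⟩ := ihD h.2 (C.run m) fun b => by rw [run_size h.1]; exact hs b
    exact ⟨_, .seq ht ht', by simpa [cost] using add_le_add htc htc'⟩
  | cond t C ih =>
    by_cases htm : t.Holds m
    · obtain ⟨u, hu, huc⟩ := ih h m hs
      refine ⟨t.time + u, ?_, ?_⟩
      · simp only [run, if_pos htm]
        exact .branchTrue htm hu
      · simp only [cost, eval_add, eval_C]
        omega
    · refine ⟨t.time + 1, ?_, ?_⟩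
      · simp only [run, if_neg htm]
        exact .branchFalse htm (.skip m)
      · simp only [cost, eval_add, eval_C]
        omega
  | loop k b C ih =>
    simp only [wf, Bool.and_eq_true] at h
    set N := m.nat (sizeArray b, 0, 0) with hN
    set P : Program := .loop (.not (.natLe (.var (sizeArray b)) (.var k)))
        (.seq C.compile (.setNat k (.const 0) (.const 0) (.add (.var k) (.const 1)))) with hP
    have hsize := rounds_size h.2 h.1.1 m
    -- Here `d` is the number of remaining rounds. The failing test takes 8 steps; a round takes 8
    -- for the test, 8 for incrementing the counter, and the cost of the body.
    have hloop : ∀ d v, v + d = N → ∃ t, Runs P (rounds k C m v) (rounds k C m N) t ∧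
        t ≤ 8 + d * (C.cost.eval s + 16) := by
      intro d
      induction d with
      | zero =>
        intro v hv
        obtain rfl : v = N := by omega
        refine ⟨_, .loopFalse ?_, le_of_eq ?_⟩
        · simp [Test.Holds, NatExpr.eval, rounds_counter, hsize, ← hN]
        · simp [Test.time, NatExpr.time]
      | succ d ihd =>
        intro v hv
        obtain ⟨t, ht, htc⟩ := ih h.2 (rounds k C m v) fun b => by rw [hsize]; exact hs b
        obtain ⟨u, hu, huc⟩ := ihd (v + 1) (by omega)
        have hk : (C.run (rounds k C m v)).nat (k, 0, 0) = v := by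
          rw [(run_frame C _ ?_ ?_ 0 0).1, rounds_counter]
          · intro hk
            have := (not_isCounter_of_mem_targets h.2 hk).1
            simp [h.1.1] at this
          · have := h.1.2
            simpa using this
        have hset := Runs.setNat k (.const 0) (.const 0) (.add (.var k) (.const 1))
          (C.run (rounds k C m v))
        simp only [NatExpr.eval, hk] at hset
        refine ⟨_, .loopTrue ?_ (.seq ht hset) hu, ?_⟩
        · simp only [Test.Holds, NatExpr.eval, rounds_counter, hsize, ← hN]
          omega
        · simp only [Test.time, NatExpr.time]
          rw [add_mul]
          omega
    obtain ⟨t, ht, htc⟩ := hloop N 0 (by omega)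
    refine ⟨_, .seq (.setNat k (.const 0) (.const 0) (.const 0) m) ht, ?_⟩
    have := Nat.mul_le_mul_right (C.cost.eval s + 16) (hs b)
    rw [← hN] at this
    simp only [cost, NatExpr.time, eval_add, eval_mul, eval_X, eval_ofNat]
    omega

/-! ### Nested loops -/

/-- Nested counting loops. -/
def nest : List (ℕ × Bool) → Command → Command
  | [], C => C
  | (k, b) :: ks, C => loop k b (nest ks C)

theorem targets_nest (ks : List (ℕ × Bool)) (C : Command) : (nest ks C).targets = C.targets := by
  induction ks with
  | nil => rfl
  | cons _ _ ih => exact ih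

theorem counters_nest (ks : List (ℕ × Bool)) (C : Command) :
    (nest ks C).counters = ks.map Prod.fst ++ C.counters := by
  induction ks with
  | nil => rfl
  | cons _ _ ih => simp [nest, counters, ih]

end Command

/-- `m` and `m'` agree outside of the arrays `S` and of the counters, and on the counters `K`. -/
def Agree (K S : List ℕ) (m m' : Memory) : Prop :=
  (∀ a, a ∉ S → isCounter a = false → ∀ i j, m.nat (a, i, j) = m'.nat (a, i, j) ∧
    m.real (a, i, j) = m'.real (a, i, j)) ∧ ∀ k ∈ K, m.nat (k, 0, 0) = m'.nat (k, 0, 0)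

theorem Agree.symm {K S : List ℕ} {m m' : Memory} (h : Agree K S m m') : Agree K S m' m :=
  ⟨fun a h1 h2 i j => ⟨(h.1 a h1 h2 i j).1.symm, (h.1 a h1 h2 i j).2.symm⟩,
    fun k hk => (h.2 k hk).symm⟩

theorem Agree.trans {K S : List ℕ} {m₁ m₂ m₃ : Memory} (h : Agree K S m₁ m₂)
    (h' : Agree K S m₂ m₃) : Agree K S m₁ m₃ :=
  ⟨fun a h1 h2 i j => ⟨(h.1 a h1 h2 i j).1.trans (h'.1 a h1 h2 i j).1,
    (h.1 a h1 h2 i j).2.trans (h'.1 a h1 h2 i j).2⟩,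
    fun k hk => (h.2 k hk).trans (h'.2 k hk)⟩

theorem Agree.upd {K S : List ℕ} {m m' : Memory} (h : Agree K S m m') {k : ℕ}
    (hk : isCounter k) (v : ℕ) : Agree (k :: K) S (m.upd k v) (m'.upd k v) := by
  refine ⟨fun a h1 h2 i j => ?_, fun k' hk' => ?_⟩
  · have : a ≠ k := by rintro rfl; simp [hk] at h2
    simpa [this] using h.1 a h1 h2 i j
  · by_cases hkk : k' = k
    · simp [hkk]
    · have := h.2 k' (by simpa [hkk] using hk')
      simp [hkk, this]

theorem Agree.size {K S : List ℕ} {m m' : Memory} (h : Agree K S m m') {b : Bool}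
    (hb : sizeArray b ∉ S) : m.nat (sizeArray b, 0, 0) = m'.nat (sizeArray b, 0, 0) :=
  (h.1 _ hb (by cases b <;> rfl) 0 0).1

theorem Command.run_agree {C : Command} (h : C.wf) {K : List ℕ}
    (hK : ∀ k ∈ K, isCounter k ∧ k ∉ C.counters) (m : Memory) :
    Agree K C.targets (C.run m) m := by
  refine ⟨fun a h1 h2 i j => C.run_frame m h1 (fun h3 => ?_) i j, fun k hk =>
    (C.run_frame m (fun h3 => ?_) (hK k hk).2 0 0).1⟩
  · have := isCounter_of_mem_counters h h3
    simp [h2] at this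
  · have := not_isCounter_of_mem_targets h h3
    simp [(hK k hk).1] at this

/-! ### Loop nests as folds over counter values -/

section Fold

variable {X : Type*}

/-- Apply `act` for all values of the counters. -/
def foldLoops (ks : List (ℕ × Bool)) (act : Memory → X → X) (m : Memory) (x : X) : X :=
  match ks with
  | [] => act m x
  | (k, b) :: ks =>
    Nat.rec x (fun v y => foldLoops ks act (m.upd k v) y) (m.nat (sizeArray b, 0, 0))

theorem foldLoops_congr {ks : List (ℕ × Bool)} {S : List ℕ} (hS : ∀ b, sizeArray b ∉ S)
    (hks : ∀ k ∈ ks, isCounter k.1) {act : Memory → X → X} {K : List ℕ}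
    (hact : ∀ m m', Agree (K ++ ks.map Prod.fst) S m m' → act m = act m') {m m' : Memory}
    (h : Agree K S m m') : foldLoops ks act m = foldLoops ks act m' := by
  induction ks generalizing K m m' with
  | nil => exact hact m m' (by simpa using h)
  | cons kb ks ih =>
    obtain ⟨k, b⟩ := kb
    have hkb : isCounter k := hks (k, b) (by simp)
    funext x
    simp only [foldLoops]
    rw [h.size (hS b)]
    congr 1
    funext v y
    refine congrFun (ih (K := k :: K) (fun k hk => hks k (by simp [hk])) (fun m m' h' => ?_)
      (h.upd hkb v)) y
    refine hact m m' ⟨h'.1, fun a ha => h'.2 a ?_⟩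
    simp only [List.map_cons, List.mem_append, List.mem_cons] at ha ⊢
    tauto

/-- The effect of nested loops on a part of the memory. -/
theorem observe_nest {ks : List (ℕ × Bool)} {C : Command} (hwf : (Command.nest ks C).wf)
    {obs : Memory → X} {act : Memory → X → X}
    (hobs : ∀ m k v, isCounter k → obs (m.upd k v) = obs m)
    (hrun : ∀ m, obs (C.run m) = act m (obs m)) {K : List ℕ}
    (hK : ∀ k ∈ K, isCounter k ∧ k ∉ (Command.nest ks C).counters)
    (hact : ∀ m m', Agree (K ++ ks.map Prod.fst) C.targets m m' → act m = act m') (m : Memory) :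
    obs ((Command.nest ks C).run m) = foldLoops ks act m (obs m) := by
  induction ks generalizing K m with
  | nil => exact hrun m
  | cons kb ks ih =>
    obtain ⟨k, b⟩ := kb
    have hw := hwf
    simp only [Command.nest, Command.wf, Bool.and_eq_true, Bool.not_eq_true'] at hw
    have hkC : k ∉ (Command.nest ks C).counters := by simpa using hw.1.2
    have hK' : ∀ k' ∈ k :: K, isCounter k' ∧ k' ∉ (Command.nest ks C).counters := by
      intro k' hk'
      rcases List.mem_cons.1 hk' with rfl | hk'
      · exact ⟨hw.1.1, hkC⟩
      · refine ⟨(hK k' hk').1, fun h => (hK k' hk').2 ?_⟩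
        simp [Command.nest, Command.counters, h]
    have hact' : ∀ m m', Agree ((k :: K) ++ ks.map Prod.fst) C.targets m m' → act m = act m' := by
      intro m m' h'
      refine hact m m' ⟨h'.1, fun a ha => h'.2 a ?_⟩
      simp only [List.map_cons, List.mem_append, List.mem_cons] at ha ⊢
      tauto
    -- After `v` rounds nothing that `act` depends on has changed except the counter, so its effect
    -- can be computed as if started from `m.upd k v`.
    have hround : ∀ v, Agree (k :: K) C.targets (Command.rounds k (Command.nest ks C) m v)
        (m.upd k v) := by
      intro v
      refine ⟨fun a h1 h2 i j => ?_, fun k' hk' => ?_⟩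
      · have hak : a ≠ k := by rintro rfl; simp [hw.1.1] at h2
        have := Command.rounds_frame k (Command.nest ks C) m (a := a)
          (by rwa [Command.targets_nest])
          (fun h3 => by
            have := Command.isCounter_of_mem_counters hw.2 h3
            simp [h2] at this) hak v i j
        simpa [hak] using this
      · by_cases hkk : k' = k
        · simp [hkk, Command.rounds_counter]
        · have := Command.rounds_frame k (Command.nest ks C) m (a := k') (fun h3 => by
            have := Command.not_isCounter_of_mem_targets hw.2 h3
            simp [(hK' k' hk').1] at this) (hK' k' hk').2 hkk v 0 0
          simpa [hkk] using this.1
    change obs (Command.rounds k (Command.nest ks C) m (m.nat (sizeArray b, 0, 0))) = _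
    rw [foldLoops]
    induction m.nat (sizeArray b, 0, 0) with
    | zero => exact hobs _ _ _ hw.1.1
    | succ v ihv =>
      rw [Command.rounds_succ, hobs _ _ _ hw.1.1, ih hw.2 hK' hact', ihv]
      refine congrFun (foldLoops_congr (K := k :: K) ?_ ?_ hact' (hround v)) _
      · intro b
        rw [← Command.targets_nest ks C]
        exact Command.sizeArray_notMem_targets hw.2 b
      · intro k' hk'
        refine Command.isCounter_of_mem_counters hw.2 ?_
        rw [Command.counters_nest]
        exact List.mem_append_left _ (List.mem_map.2 ⟨k', hk', rfl⟩)

end Fold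

/-- Some values of the counters satisfy `p`. -/
def ExistsLoops (ks : List (ℕ × Bool)) (p : Memory → Prop) (m : Memory) : Prop :=
  match ks with
  | [] => p m
  | (k, b) :: ks => ∃ v < m.nat (sizeArray b, 0, 0), ExistsLoops ks p (m.upd k v)

/-- The sum of `g` over all values of the counters. -/
def sumLoops {M : Type*} [AddCommMonoid M] (ks : List (ℕ × Bool)) (g : Memory → M) (m : Memory) :
    M :=
  match ks with
  | [] => g m
  | (k, b) :: ks =>
    ∑ v ∈ Finset.range (m.nat (sizeArray b, 0, 0)), sumLoops ks g (m.upd k v)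

open Classical in
theorem foldLoops_ite {X : Type*} (ks : List (ℕ × Bool)) (p : Memory → Prop) [DecidablePred p]
    (y : X) (m : Memory) (x : X) : foldLoops ks (fun m x => if p m then y else x) m x =
      if ExistsLoops ks p m then y else x := by
  induction ks generalizing m x with
  | nil => exact if_congr Iff.rfl rfl rfl
  | cons kb ks ih =>
    obtain ⟨k, b⟩ := kb
    have key : ∀ N, Nat.rec x (fun v z => if ExistsLoops ks p (m.upd k v) then y else z) N =
        if ∃ v < N, ExistsLoops ks p (m.upd k v) then y else x := by
      intro N
      induction N with
      | zero => simp
      | succ v ihv =>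
        simp only [ihv]
        by_cases h : ExistsLoops ks p (m.upd k v)
        · rw [if_pos h, if_pos ⟨v, by omega, h⟩]
        · rw [if_neg h]
          congr 1
          refine propext ⟨fun ⟨u, hu, h'⟩ => ⟨u, by omega, h'⟩, fun ⟨u, hu, h'⟩ => ⟨u, ?_, h'⟩⟩
          have : u ≠ v := by rintro rfl; exact h h'
          omega
    simp only [foldLoops, ih]
    exact (key _).trans (if_congr Iff.rfl rfl rfl)

theorem foldLoops_add {M : Type*} [AddCommMonoid M] (ks : List (ℕ × Bool)) (g : Memory → M)
    (m : Memory) (x : M) : foldLoops ks (fun m x => x + g m) m x = x + sumLoops ks g m := by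
  induction ks generalizing m x with
  | nil => rfl
  | cons kb ks ih =>
    obtain ⟨k, b⟩ := kb
    simp only [foldLoops, sumLoops, ih]
    induction m.nat (sizeArray b, 0, 0) with
    | zero => simp
    | succ v ihv => simp only [ihv, Finset.sum_range_succ, add_assoc]

/-- The fold that sets an indicator from `0` to `1` computes the existential statement, so the
congruence of folds applies. -/
theorem existsLoops_congr {ks : List (ℕ × Bool)} {S : List ℕ} (hS : ∀ b, sizeArray b ∉ S)
    (hks : ∀ k ∈ ks, isCounter k.1) {p : Memory → Prop}
    (hp : ∀ m m', Agree (ks.map Prod.fst) S m m' → (p m ↔ p m')) {m m' : Memory}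
    (h : Agree [] S m m') : ExistsLoops ks p m ↔ ExistsLoops ks p m' := by
  classical
  have := congrFun (foldLoops_congr (X := ℕ) (K := []) hS hks
    (act := fun m x => if p m then 1 else x)
    (fun m m' h => by funext x; simp only [hp m m' (by simpa using h)]) h) 0
  rw [foldLoops_ite, foldLoops_ite] at this
  by_cases h1 : ExistsLoops ks p m <;> by_cases h2 : ExistsLoops ks p m' <;> simp_all

theorem sumLoops_congr {M : Type*} [AddCommMonoid M] {ks : List (ℕ × Bool)} {S : List ℕ}
    (hS : ∀ b, sizeArray b ∉ S) (hks : ∀ k ∈ ks, isCounter k.1) {g : Memory → M}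
    (hg : ∀ m m', Agree (ks.map Prod.fst) S m m' → g m = g m') {m m' : Memory}
    (h : Agree [] S m m') : sumLoops ks g m = sumLoops ks g m' := by
  have := congrFun (foldLoops_congr (X := M) (K := []) hS hks (act := fun m x => x + g m)
    (fun m m' h => by funext x; simp [hg m m' (by simpa using h)]) h) 0
  simpa [foldLoops_add] using this

/-! ### Arrays that are written by one loop nest -/

/-- Whether an expression is the constant `0`. -/
def NatExpr.isZero : NatExpr → Bool
  | const 0 => true
  | _ => false

/-- Whether an expression reads only counters in `K` and other arrays outside of `S`. -/
def NatExpr.reads (K S : List ℕ) : NatExpr → Bool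
  | const _ => true
  | cell a i j => (if isCounter a then K.contains a && i.isZero && j.isZero else !S.contains a) &&
      i.reads K S && j.reads K S
  | add e f => e.reads K S && f.reads K S
  | sub e f => e.reads K S && f.reads K S

/-- Whether an expression reads only counters in `K` and other arrays outside of `S`. -/
def RealExpr.reads (K S : List ℕ) : RealExpr → Bool
  | zero => true
  | cell a i j => !isCounter a && !S.contains a && i.reads K S && j.reads K S
  | add e f => e.reads K S && f.reads K S

/-- Whether a test reads only counters in `K` and other arrays outside of `S`. -/
def Test.reads (K S : List ℕ) : Test → Bool
  | natLe e f => e.reads K S && f.reads K S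
  | realLe e f => e.reads K S && f.reads K S
  | not t => t.reads K S
  | and t u => t.reads K S && u.reads K S

theorem NatExpr.eq_const_of_isZero {e : NatExpr} (h : e.isZero) : e = .const 0 := by
  unfold isZero at h
  split at h
  · rfl
  · simp at h

theorem NatExpr.eval_congr {K S : List ℕ} {m m' : Memory} (h : Agree K S m m') {e : NatExpr}
    (he : e.reads K S) : e.eval m = e.eval m' := by
  induction e with
  | const => rfl
  | cell a i j ihi ihj =>
    simp only [reads, Bool.and_eq_true] at he
    simp only [eval]
    by_cases ha : isCounter a
    · simp only [ha, if_true, Bool.and_eq_true, List.contains_iff_mem] at he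
      rw [eq_const_of_isZero he.1.1.1.2, eq_const_of_isZero he.1.1.2]
      exact h.2 a he.1.1.1.1
    · rw [ihi he.1.2, ihj he.2]
      exact (h.1 a (by simpa [ha] using he.1.1) (by simpa using ha) _ _).1
  | add e f ihe ihf =>
    simp only [reads, Bool.and_eq_true] at he
    simp only [eval, ihe he.1, ihf he.2]
  | sub e f ihe ihf =>
    simp only [reads, Bool.and_eq_true] at he
    simp only [eval, ihe he.1, ihf he.2]

theorem RealExpr.eval_congr {K S : List ℕ} {m m' : Memory} (h : Agree K S m m') {e : RealExpr}
    (he : e.reads K S) : e.eval m = e.eval m' := by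
  induction e with
  | zero => rfl
  | cell a i j =>
    simp only [reads, Bool.and_eq_true, Bool.not_eq_true'] at he
    simp only [eval, NatExpr.eval_congr h he.1.2, NatExpr.eval_congr h he.2]
    exact (h.1 a (by simpa using he.1.1.2) he.1.1.1 _ _).2
  | add e f ihe ihf =>
    simp only [reads, Bool.and_eq_true] at he
    simp only [eval, ihe he.1, ihf he.2]

theorem Test.holds_congr {K S : List ℕ} {m m' : Memory} (h : Agree K S m m') {t : Test}
    (ht : t.reads K S) : t.Holds m ↔ t.Holds m' := by
  induction t with
  | natLe e f =>
    simp only [reads, Bool.and_eq_true] at ht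
    simp only [Holds, NatExpr.eval_congr h ht.1, NatExpr.eval_congr h ht.2]
  | realLe e f =>
    simp only [reads, Bool.and_eq_true] at ht
    simp only [Holds, RealExpr.eval_congr h ht.1, RealExpr.eval_congr h ht.2]
  | not t ih => simp only [Holds, ih ht]
  | and t u iht ihu =>
    simp only [reads, Bool.and_eq_true] at ht
    simp only [Holds, iht ht.1, ihu ht.2]

/-- Whether a loop nest that writes the array `B`, with test `t` and indices `i` and `j`, can be
followed by `D` without changes of `B` or of what the test and the indices depend on. -/
def stable (ks : List (ℕ × Bool)) (t : Test) (B : ℕ) (i j : NatExpr) (D : Command) : Bool :=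
  (Command.nest ks (.set B i j (.const 0))).wf && D.wf && !D.targets.contains B &&
    t.reads (ks.map Prod.fst) (B :: D.targets) && i.reads (ks.map Prod.fst) (B :: D.targets) &&
    j.reads (ks.map Prod.fst) (B :: D.targets)

theorem Command.wf_nest_iff {ks : List (ℕ × Bool)} {C D : Command} (hw : C.wf = D.wf)
    (hc : C.counters = D.counters) : (nest ks C).wf = (nest ks D).wf := by
  induction ks with
  | nil => exact hw
  | cons kb ks ih => simp [nest, wf, ih, counters_nest, hc]

/-- What `stable` provides for a loop nest with a given body. -/
theorem stable_spec {ks : List (ℕ × Bool)} {t : Test} {B : ℕ} {i j : NatExpr} {D : Command}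
    (h : stable ks t B i j D) {C : Command} (hC : C.targets = [B]) (hC' : C.counters = [])
    (hw : C.wf = (Command.set B i j (.const 0)).wf) :
    (Command.nest ks C).wf ∧ isCounter B = false ∧ (∀ b, sizeArray b ∉ B :: D.targets) ∧
      (∀ k ∈ ks, isCounter k.1) ∧
      (∀ m m', Agree (ks.map Prod.fst) (B :: D.targets) m m' →
        (t.Holds m ↔ t.Holds m') ∧ i.eval m = i.eval m' ∧ j.eval m = j.eval m') ∧
      ∀ m p q, Agree [] (B :: D.targets) ((Command.nest ks C).run m)
          (D.run ((Command.nest ks C).run m)) ∧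
        (D.run ((Command.nest ks C).run m)).nat (B, p, q) =
          ((Command.nest ks C).run m).nat (B, p, q) ∧
        (D.run ((Command.nest ks C).run m)).real (B, p, q) =
          ((Command.nest ks C).run m).real (B, p, q) := by
  simp only [stable, Bool.and_eq_true, Bool.not_eq_true'] at h
  obtain ⟨⟨⟨⟨⟨h1, h2⟩, h3⟩, h4⟩, h5⟩, h6⟩ := h
  have h3' : B ∉ D.targets := by simpa using h3
  have hwf : (Command.nest ks C).wf := by
    rw [Command.wf_nest_iff hw (by rw [hC']; rfl)]
    exact h1
  have hB := Command.not_isCounter_of_mem_targets hwf (a := B) (by simp [Command.targets_nest, hC])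
  refine ⟨hwf, hB.1, fun b => ?_, fun k hk => ?_, fun m m' hm => ⟨Test.holds_congr hm h4,
    NatExpr.eval_congr hm h5, NatExpr.eval_congr hm h6⟩, fun m p q => ⟨?_, ?_⟩⟩
  · have := Command.sizeArray_notMem_targets h2 b
    rw [List.mem_cons, not_or]
    refine ⟨?_, this⟩
    cases b
    · exact hB.2.1.symm
    · exact hB.2.2.symm
  · refine Command.isCounter_of_mem_counters hwf ?_
    rw [Command.counters_nest]
    exact List.mem_append_left _ (List.mem_map.2 ⟨k, hk, rfl⟩)
  · have := (Command.run_agree h2 (K := []) (by simp) ((Command.nest ks C).run m)).symm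
    exact ⟨fun a ha => this.1 a fun h => ha (List.mem_cons_of_mem _ h), this.2⟩
  · refine Command.run_frame D _ h3' (fun h => ?_) p q
    have := Command.isCounter_of_mem_counters h2 h
    simp [hB.1] at this

theorem nest_agree {ks : List (ℕ × Bool)} {C : Command} (h : (Command.nest ks C).wf) {B : ℕ}
    {S : List ℕ} (hC : C.targets = [B]) (m : Memory) :
    Agree [] (B :: S) m ((Command.nest ks C).run m) := by
  have := (Command.run_agree h (K := []) (by simp) m).symm
  rw [Command.targets_nest, hC] at this
  exact ⟨fun a ha => this.1 a fun h => ha (by simp_all), this.2⟩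

/-- Put `1` in row `i` and column `j` of the array `B` if the test succeeds. -/
def Command.mark (ks : List (ℕ × Bool)) (t : Test) (B : ℕ) (i j : NatExpr) : Command :=
  nest ks (.cond t (.set B i j (.const 1)))

open Classical in
-- By `stable`, neither the loop nest nor `D` changes what the test and the indices read, apart from
-- counters, which `ExistsLoops` sets itself. The condition may therefore be evaluated after `D`,
-- which allows all arrays to be described in one final memory.
theorem run_mark {ks : List (ℕ × Bool)} {t : Test} {B : ℕ} {i j : NatExpr} {D : Command}
    (h : stable ks t B i j D) (m : Memory) (p q : ℕ) :
    (D.run ((Command.mark ks t B i j).run m)).nat (B, p, q) =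
      if ExistsLoops ks (fun m => t.Holds m ∧ p = i.eval m ∧ q = j.eval m)
        (D.run ((Command.mark ks t B i j).run m)) then 1 else m.nat (B, p, q) := by
  obtain ⟨h1, h2, h3, h4, h5, h6⟩ :=
    stable_spec (C := .cond t (.set B i j (.const 1))) h rfl rfl rfl
  -- Each cell of `B` is observed separately.
  have hobs := observe_nest (X := ℕ) (K := []) h1 (obs := fun m => m.nat (B, p, q))
    (act := fun m x => if t.Holds m ∧ p = i.eval m ∧ q = j.eval m then 1 else x)
    (fun m k v hk => by
      have : B ≠ k := by rintro rfl; simp [hk] at h2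
      simp [this])
    (fun m => by
      by_cases ht : t.Holds m <;> simp [Command.run, ht, Function.update_apply, NatExpr.eval])
    (by simp)
    (fun m m' hm => by
      have := h5 m m' ⟨fun a ha => hm.1 a (by simp_all [Command.targets]), by simpa using hm.2⟩
      funext x
      simp only [this.1, this.2.1, this.2.2]) m
  rw [foldLoops_ite] at hobs
  refine (h6 m p q).2.1.trans (hobs.trans (if_congr ?_ rfl rfl))
  refine existsLoops_congr h3 h4 (fun m m' hm => ?_) ((nest_agree h1 rfl m).trans (h6 m p q).1)
  simp only [(h5 m m' hm).1, (h5 m m' hm).2.1, (h5 m m' hm).2.2]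

/-- Count how often the test succeeds. -/
def Command.count (ks : List (ℕ × Bool)) (t : Test) (B : ℕ) (i j : NatExpr) : Command :=
  nest ks (.cond t (.set B i j (.add (.cell B i j) (.const 1))))

open Classical in
theorem run_count {ks : List (ℕ × Bool)} {t : Test} {B : ℕ} {i j : NatExpr} {D : Command}
    (h : stable ks t B i j D) (m : Memory) (p q : ℕ) :
    (D.run ((Command.count ks t B i j).run m)).nat (B, p, q) = m.nat (B, p, q) +
      sumLoops ks (fun m => if t.Holds m ∧ p = i.eval m ∧ q = j.eval m then 1 else 0)
        (D.run ((Command.count ks t B i j).run m)) := by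
  obtain ⟨h1, h2, h3, h4, h5, h6⟩ :=
    stable_spec (C := .cond t (.set B i j (.add (.cell B i j) (.const 1)))) h rfl rfl rfl
  have hobs := observe_nest (X := ℕ) (K := []) h1 (obs := fun m => m.nat (B, p, q))
    (act := fun m x => x + if t.Holds m ∧ p = i.eval m ∧ q = j.eval m then 1 else 0)
    (fun m k v hk => by
      have : B ≠ k := by rintro rfl; simp [hk] at h2
      simp [this])
    (fun m => by
      by_cases ht : t.Holds m
      · simp only [Command.run, ht, if_true, Function.update_apply, NatExpr.eval, Prod.mk.injEq,
          true_and]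
        split_ifs with hpq
        · rw [hpq.1, hpq.2]
        · rfl
      · simp [Command.run, ht])
    (by simp)
    (fun m m' hm => by
      have := h5 m m' ⟨fun a ha => hm.1 a (by simp_all [Command.targets]), by simpa using hm.2⟩
      funext x
      simp only [this.1, this.2.1, this.2.2]) m
  rw [foldLoops_add] at hobs
  refine (h6 m p q).2.1.trans (hobs.trans (congrArg _ ?_))
  refine sumLoops_congr h3 h4 (fun m m' hm => ?_) ((nest_agree h1 rfl m).trans (h6 m p q).1)
  simp only [(h5 m m' hm).1, (h5 m m' hm).2.1, (h5 m m' hm).2.2]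

/-- Add up the values of `d` for which the test succeeds. -/
def Command.total (ks : List (ℕ × Bool)) (t : Test) (B : ℕ) (i j : NatExpr) (d : RealExpr) :
    Command :=
  nest ks (.cond t (.setReal B i j (.add (.cell B i j) d)))

open Classical in
theorem run_total {ks : List (ℕ × Bool)} {t : Test} {B : ℕ} {i j : NatExpr} {d : RealExpr}
    {D : Command} (h : stable ks t B i j D) (hd : d.reads (ks.map Prod.fst) (B :: D.targets))
    (m : Memory) (p q : ℕ) :
    (D.run ((Command.total ks t B i j d).run m)).real (B, p, q) = m.real (B, p, q) +
      sumLoops ks (fun m => if t.Holds m ∧ p = i.eval m ∧ q = j.eval m then d.eval m else 0)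
        (D.run ((Command.total ks t B i j d).run m)) := by
  obtain ⟨h1, h2, h3, h4, h5, h6⟩ :=
    stable_spec (C := .cond t (.setReal B i j (.add (.cell B i j) d))) h rfl rfl rfl
  have hobs := observe_nest (X := ℝ) (K := []) h1 (obs := fun m => m.real (B, p, q))
    (act := fun m x => x + if t.Holds m ∧ p = i.eval m ∧ q = j.eval m then d.eval m else 0)
    (fun m k v hk => by simp)
    (fun m => by
      by_cases ht : t.Holds m
      · simp only [Command.run, ht, if_true, Function.update_apply, RealExpr.eval, Prod.mk.injEq,
          true_and]
        split_ifs with hpq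
        · rw [hpq.1, hpq.2]
        · rw [add_zero]
      · simp [Command.run, ht])
    (by simp)
    (fun m m' hm => by
      have := h5 m m' ⟨fun a ha => hm.1 a (by simp_all [Command.targets]), by simpa using hm.2⟩
      have hd' := RealExpr.eval_congr (m := m) (m' := m')
        ⟨fun a ha => hm.1 a (by simp_all [Command.targets]), by simpa using hm.2⟩ hd
      funext x
      simp only [this.1, this.2.1, this.2.2, hd']) m
  rw [foldLoops_add] at hobs
  refine (h6 m p q).2.2.trans (hobs.trans (congrArg _ ?_))
  refine sumLoops_congr h3 h4 (fun m m' hm => ?_) ((nest_agree h1 rfl m).trans (h6 m p q).1)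
  simp only [(h5 m m' hm).1, (h5 m m' hm).2.1, (h5 m m' hm).2.2, RealExpr.eval_congr hm hd]

/-! ### Labels -/

theorem rec_preserves {X : Type*} {f : ℕ → X → X} {P : X → Prop} {N : ℕ}
    (hf : ∀ v < N, ∀ x, P x → P (f v x)) {x : X} (hx : P x) :
    P (Nat.rec (motive := fun _ => X) x f N) := by
  induction N with
  | zero => exact hx
  | succ N ih => exact hf N (by omega) _ (ih fun v hv => hf v (by omega))

/-- Round `v` produces the property from any state and later rounds keep it. -/
theorem rec_establishes {X : Type*} {f : ℕ → X → X} {P : X → Prop} {N v : ℕ} (hv : v < N)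
    (hf : ∀ u < N, ∀ x, P x → P (f u x)) (hfv : ∀ x, P (f v x)) (x : X) :
    P (Nat.rec (motive := fun _ => X) x f N) := by
  induction N with
  | zero => omega
  | succ N ih =>
    by_cases h : v = N
    · subst h; exact hfv _
    · exact hf N (by omega) _ (ih (by omega) fun u hu => hf u (by omega))

/-- Give all indices below `N` with the label of `j` the label of `i`. -/
def mergeLabels (N : ℕ) (L : ℕ → ℕ) (i j k : ℕ) : ℕ :=
  if k < N ∧ L k = L j then L i else L k

/-- Whether two numbers are equal. -/
def Test.eq (e f : NatExpr) : Test := .and (.natLe e f) (.natLe f e)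

/-- Whether a cell is positive. -/
def Test.pos (a : ℕ) (i j : NatExpr) : Test := .natLe (.const 1) (.cell a i j)

@[simp] theorem Test.holds_eq (m : Memory) (e f : NatExpr) :
    (Test.eq e f).Holds m ↔ e.eval m = f.eval m := le_antisymm_iff.symm

@[simp] theorem Test.holds_pos (m : Memory) (a : ℕ) (i j : NatExpr) :
    (Test.pos a i j).Holds m ↔ 1 ≤ m.nat (a, i.eval m, j.eval m) := Iff.rfl

namespace Command

/-- Label each community with its number. -/
def initLabels : Command :=
  nest [(10, true)] (.set 23 (.var 10) (.const 0) (.var 10))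

/-- Replace the label stored in array `32` by the label stored in array `31`. -/
def replaceLabel : Command :=
  nest [(12, true)] (.cond (.eq (.cell 23 (.var 12) (.const 0)) (.var 32))
    (.set 23 (.var 12) (.const 0) (.var 31)))

/-- Merge the labels of tied communities. -/
def mergeTied : Command :=
  nest [(10, true), (11, true)] (.cond (.pos 22 (.var 10) (.var 11))
    (.seq (.set 31 (.const 0) (.const 0) (.cell 23 (.var 10) (.const 0)))
      (.seq (.set 32 (.const 0) (.const 0) (.cell 23 (.var 11) (.const 0))) replaceLabel)))

end Command

theorem upd_nat_of_ne (m : Memory) {k a : ℕ} (h : a ≠ k) (v i j : ℕ) :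
    (m.upd k v).nat (a, i, j) = m.nat (a, i, j) := by simp [h]

theorem nat_upd_of_isCounter (m : Memory) {k a : ℕ} (hk : isCounter k) (ha : isCounter a = false)
    (v i j : ℕ) : (m.upd k v).nat (a, i, j) = m.nat (a, i, j) :=
  upd_nat_of_ne m (by rintro rfl; simp [hk] at ha) v i j

open Command in
theorem run_initLabels (m : Memory) (k : ℕ) (hk : k < m.nat (30, 0, 0)) :
    (initLabels.run m).nat (23, k, 0) = k := by
  have hobs := observe_nest (X := ℕ) (K := []) (ks := [(10, true)])
    (C := .set 23 (.var 10) (.const 0) (.var 10)) rfl (obs := fun m => m.nat (23, k, 0))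
    (act := fun m x => if k = m.nat (10, 0, 0) then m.nat (10, 0, 0) else x)
    (fun m k v hk => nat_upd_of_isCounter m hk rfl v _ _)
    (fun m => by simp [run, NatExpr.eval, Function.update_apply])
    (by simp)
    (fun m m' hm => by
      funext x
      rw [hm.2 10 (by simp)]) m
  refine hobs.trans ?_
  simp only [foldLoops]
  refine rec_establishes (P := fun x => x = k) (v := k) hk ?_ ?_ _
  · intro u _ x hx
    simp only [Memory.upd_nat, and_self, if_true]
    split_ifs with h
    · exact h.symm
    · exact hx
  · intro x
    simp

open Command in
-- The two labels involved are read from arrays `31` and `32`, which stay fixed while array `23` is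
-- overwritten, and each entry is visited once. The sequential updates therefore amount to a
-- simultaneous replacement.
theorem run_replaceLabel (m : Memory) (k : ℕ) :
    (replaceLabel.run m).nat (23, k, 0) =
      if k < m.nat (30, 0, 0) ∧ m.nat (23, k, 0) = m.nat (32, 0, 0) then m.nat (31, 0, 0)
      else m.nat (23, k, 0) := by
  have hobs := observe_nest (X := ℕ) (K := []) (ks := [(12, true)])
    (C := .cond (.eq (.cell 23 (.var 12) (.const 0)) (.var 32))
      (.set 23 (.var 12) (.const 0) (.var 31))) rfl (obs := fun m => m.nat (23, k, 0))
    (act := fun m x =>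
      if k = m.nat (12, 0, 0) ∧ x = m.nat (32, 0, 0) then m.nat (31, 0, 0) else x)
    (fun m k v hk => nat_upd_of_isCounter m hk rfl v _ _)
    (fun m => by
      simp only [run, Test.holds_eq, NatExpr.eval]
      by_cases h : k = m.nat (12, 0, 0)
      · subst h
        by_cases h' : m.nat (23, m.nat (12, 0, 0), 0) = m.nat (32, 0, 0) <;> simp [h']
      · by_cases h' : m.nat (23, m.nat (12, 0, 0), 0) = m.nat (32, 0, 0) <;>
          simp [h, h'])
    (by simp)
    (fun m m' hm => by
      funext x
      rw [hm.2 12 (by simp), (hm.1 31 (by simp [targets]) rfl 0 0).1,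
        (hm.1 32 (by simp [targets]) rfl 0 0).1]) m
  refine hobs.trans ?_
  simp only [foldLoops, sizeArray, if_true, Memory.upd_nat, Nat.reduceEqDiff, false_and, and_self,
    if_false]
  generalize m.nat (30, 0, 0) = N
  induction N with
  | zero => simp
  | succ v ih =>
    simp only [ih]
    by_cases h : k = v
    · subst h
      simp
    · have : k < v + 1 ↔ k < v := by omega
      simp [h, this]

open Command in
theorem run_mergeTied (m : Memory) :
    (fun k => (mergeTied.run m).nat (23, k, 0)) =
      Nat.rec (motive := fun _ => ℕ → ℕ) (fun k => m.nat (23, k, 0)) (fun i L =>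
        Nat.rec (motive := fun _ => ℕ → ℕ) L (fun j L =>
          if 1 ≤ m.nat (22, i, j) then mergeLabels (m.nat (30, 0, 0)) L i j else L)
          (m.nat (30, 0, 0))) (m.nat (30, 0, 0)) := by
  have hobs := observe_nest (X := ℕ → ℕ) (K := []) (ks := [(10, true), (11, true)])
    (C := .cond (.pos 22 (.var 10) (.var 11))
      (.seq (.set 31 (.const 0) (.const 0) (.cell 23 (.var 10) (.const 0)))
        (.seq (.set 32 (.const 0) (.const 0) (.cell 23 (.var 11) (.const 0))) replaceLabel)))
    rfl (obs := fun m k => m.nat (23, k, 0))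
    (act := fun m L => if 1 ≤ m.nat (22, m.nat (10, 0, 0), m.nat (11, 0, 0)) then
      mergeLabels (m.nat (30, 0, 0)) L (m.nat (10, 0, 0)) (m.nat (11, 0, 0)) else L)
    (fun m k v hk => by
      funext k'
      exact nat_upd_of_isCounter m hk rfl v _ _)
    (fun m => by
      funext k
      by_cases h : 1 ≤ m.nat (22, m.nat (10, 0, 0), m.nat (11, 0, 0))
      · simp only [run, Test.holds_pos, NatExpr.eval, h, if_true, run_replaceLabel]
        simp [mergeLabels]
      · simp only [run, Test.holds_pos, NatExpr.eval, h, if_false])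
    (by simp)
    (fun m m' hm => by
      funext x
      rw [hm.2 10 (by simp), hm.2 11 (by simp),
        (hm.1 22 (by simp [targets, targets_nest, replaceLabel]) rfl _ _).1,
        (hm.1 30 (by simp [targets, targets_nest, replaceLabel]) rfl 0 0).1]) m
  refine hobs.trans ?_
  simp [foldLoops, sizeArray]

open Command in
/-- The labels are equal for tied communities, and only if they have to be. -/
theorem run_labels (m : Memory) :
    (∀ i < m.nat (30, 0, 0),
      (mergeTied.run (initLabels.run m)).nat (23, i, 0) < m.nat (30, 0, 0)) ∧
    (∀ i < m.nat (30, 0, 0), ∀ j < m.nat (30, 0, 0), 1 ≤ m.nat (22, i, j) →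
      (mergeTied.run (initLabels.run m)).nat (23, i, 0) =
        (mergeTied.run (initLabels.run m)).nat (23, j, 0)) ∧
    ∀ g : ℕ → ℕ, (∀ i < m.nat (30, 0, 0), ∀ j < m.nat (30, 0, 0), 1 ≤ m.nat (22, i, j) →
        g i = g j) →
      ∀ i < m.nat (30, 0, 0), ∀ j < m.nat (30, 0, 0),
        (mergeTied.run (initLabels.run m)).nat (23, i, 0) =
          (mergeTied.run (initLabels.run m)).nat (23, j, 0) → g i = g j := by
  have hc : (initLabels.run m).nat (30, 0, 0) = m.nat (30, 0, 0) :=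
    run_size (C := initLabels) rfl m true
  have hT : ∀ i j, (initLabels.run m).nat (22, i, j) = m.nat (22, i, j) := fun i j =>
    (run_frame initLabels m (by simp [initLabels, targets_nest, targets])
      (by simp [initLabels, counters_nest, counters]) i j).1
  have hrun := run_mergeTied (initLabels.run m)
  have hinit := run_initLabels m
  simp only [hc, hT] at hrun
  generalize m.nat (30, 0, 0) = N at *
  set L := fun k => (mergeTied.run (initLabels.run m)).nat (23, k, 0) with hL
  change (∀ i < N, L i < N) ∧ (∀ i < N, ∀ j < N, 1 ≤ m.nat (22, i, j) → L i = L j) ∧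
    ∀ g : ℕ → ℕ, (∀ i < N, ∀ j < N, 1 ≤ m.nat (22, i, j) → g i = g j) →
      ∀ i < N, ∀ j < N, L i = L j → g i = g j
  refine ⟨?_, ?_, ?_⟩
  · rw [hrun]
    refine rec_preserves (P := fun L : ℕ → ℕ => ∀ i < N, L i < N) (fun i hi L hLi =>
      rec_preserves (P := fun L : ℕ → ℕ => ∀ i < N, L i < N) (fun j hj L hLj k hk => ?_) hLi)
      (fun i hi => by rw [hinit i hi]; exact hi)
    split_ifs
    · rw [mergeLabels]
      split_ifs
      · exact hLj i hi
      · exact hLj k hk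
    · exact hLj k hk
  · intro i hi j hj hij
    rw [hrun]
    -- The new label of an index below `N` depends only on its old label, so equal labels stay
    -- equal.
    have hpres : ∀ a b (L : ℕ → ℕ), L i = L j →
        (if 1 ≤ m.nat (22, a, b) then mergeLabels N L a b else L) i =
          (if 1 ≤ m.nat (22, a, b) then mergeLabels N L a b else L) j := by
      intro a b L hLij
      split_ifs
      · simp only [mergeLabels, hi, hj, true_and, hLij]
      · exact hLij
    refine rec_establishes (P := fun L : ℕ → ℕ => L i = L j) hi
      (fun a _ L hL => rec_preserves (P := fun L : ℕ → ℕ => L i = L j)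
        (fun b _ L hL => hpres a b L hL) hL)
      (fun L => rec_establishes (P := fun L : ℕ → ℕ => L i = L j) hj
        (fun b _ L hL => hpres i b L hL) (fun L => ?_) L) _
    simp only [if_pos hij, mergeLabels, hi, hj, true_and, if_true]
    split_ifs <;> rfl
  · intro g hg
    rw [hrun]
    -- The invariant says that `g` is constant on each label class. It holds for the initial
    -- distinct labels, and a merge only joins classes of a pair on which `g` agrees.
    refine rec_preserves (P := fun L : ℕ → ℕ => ∀ i < N, ∀ j < N, L i = L j → g i = g j)
      (fun a ha L hLa => rec_preserves
        (P := fun L : ℕ → ℕ => ∀ i < N, ∀ j < N, L i = L j → g i = g j)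
        (fun b hb L hLb i hi j hj hij => ?_) hLa)
      (fun i hi j hj hij => by rw [hinit i hi, hinit j hj] at hij; rw [hij])
    by_cases hab : 1 ≤ m.nat (22, a, b)
    · simp only [if_pos hab, mergeLabels, hi, hj, true_and] at hij
      have hgab := hg a ha b hb hab
      split_ifs at hij with h1 h2 h2
      · exact (hLb i hi b hb h1).trans (hLb j hj b hb h2).symm
      · exact ((hLb i hi b hb h1).trans hgab.symm).trans (hLb a ha j hj hij)
      · exact ((hLb i hi a ha hij).trans hgab).trans (hLb j hj b hb h2).symm
      · exact hLb i hi j hj hij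
    · simp only [if_neg hab] at hij
      exact hLb i hi j hj hij

/-! ### The algorithm -/

/-- Run commands one after the other. -/
def Command.block : List Command → Command
  | [] => .skip
  | C :: l => .seq C (block l)

theorem Command.run_block_append (l l' : List Command) (m : Memory) :
    (block (l ++ l')).run m = (block l').run ((block l).run m) := by
  induction l generalizing m with
  | nil => rfl
  | cons C l ih => exact ih (C.run m)

/-- Whether a loop nest that writes the array `B` may stand between two lists of commands. -/
def wellPlaced (pre : List Command) (ks : List (ℕ × Bool)) (t : Test) (B : ℕ) (i j : NatExpr)
    (post : List Command) : Bool :=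
  stable ks t B i j (.block post) && (Command.block pre).wf &&
    !(Command.block pre).targets.contains B && !isCounter B

theorem stable_of_wellPlaced {pre : List Command} {ks : List (ℕ × Bool)} {t : Test} {B : ℕ}
    {i j : NatExpr} {post : List Command} (h : wellPlaced pre ks t B i j post) :
    stable ks t B i j (.block post) := by
  simp only [wellPlaced, Bool.and_eq_true] at h
  exact h.1.1.1

theorem run_pre_of_wellPlaced {pre : List Command} {ks : List (ℕ × Bool)} {t : Test} {B : ℕ}
    {i j : NatExpr} {post : List Command} (h : wellPlaced pre ks t B i j post) (m : Memory)
    (p q : ℕ) : ((Command.block pre).run m).nat (B, p, q) = m.nat (B, p, q) ∧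
      ((Command.block pre).run m).real (B, p, q) = m.real (B, p, q) := by
  simp only [wellPlaced, Bool.and_eq_true, Bool.not_eq_true'] at h
  refine Command.run_frame _ m (by simpa using h.1.2) (fun h' => ?_) p q
  have := Command.isCounter_of_mem_counters h.1.1.2 h'
  simp [h.2] at this

theorem pos_mark {l pre post : List Command} {ks : List (ℕ × Bool)} {t : Test} {B : ℕ}
    {i j : NatExpr} (hl : l = pre ++ .mark ks t B i j :: post)
    (h : wellPlaced pre ks t B i j post) {m : Memory} {p q : ℕ} (hm : m.nat (B, p, q) = 0) :
    1 ≤ ((Command.block l).run m).nat (B, p, q) ↔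
      ExistsLoops ks (fun m => t.Holds m ∧ p = i.eval m ∧ q = j.eval m)
        ((Command.block l).run m) := by
  classical
  rw [hl, Command.run_block_append]
  have := run_mark (stable_of_wellPlaced h) ((Command.block pre).run m) p q
  rw [(run_pre_of_wellPlaced h m p q).1, hm] at this
  simp only [Command.block, Command.run]
  rw [this]
  split_ifs with h' <;> simp [h']

open Classical in
theorem nat_count {l pre post : List Command} {ks : List (ℕ × Bool)} {t : Test} {B : ℕ}
    {i j : NatExpr} (hl : l = pre ++ .count ks t B i j :: post)
    (h : wellPlaced pre ks t B i j post) {m : Memory} {p q : ℕ} (hm : m.nat (B, p, q) = 0) :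
    ((Command.block l).run m).nat (B, p, q) =
      sumLoops ks (fun m => if t.Holds m ∧ p = i.eval m ∧ q = j.eval m then 1 else 0)
        ((Command.block l).run m) := by
  rw [hl, Command.run_block_append]
  have := run_count (stable_of_wellPlaced h) ((Command.block pre).run m) p q
  rw [(run_pre_of_wellPlaced h m p q).1, hm, zero_add] at this
  exact this

open Classical in
theorem real_total {l pre post : List Command} {ks : List (ℕ × Bool)} {t : Test} {B : ℕ}
    {i j : NatExpr} {d : RealExpr} (hl : l = pre ++ .total ks t B i j d :: post)
    (h : wellPlaced pre ks t B i j post)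
    (hd : d.reads (ks.map Prod.fst) (B :: (Command.block post).targets))
    {m : Memory} {p q : ℕ} (hm : m.real (B, p, q) = 0) :
    ((Command.block l).run m).real (B, p, q) =
      sumLoops ks (fun m => if t.Holds m ∧ p = i.eval m ∧ q = j.eval m then d.eval m else 0)
        ((Command.block l).run m) := by
  rw [hl, Command.run_block_append]
  have := run_total (stable_of_wellPlaced h) hd ((Command.block pre).run m) p q
  rw [(run_pre_of_wellPlaced h m p q).2, hm, zero_add] at this
  exact this

/-- Disjunction. -/
def Test.or (t u : Test) : Test := .not (.and (.not t) (.not u))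

/-- Whether two numbers are different. -/
def Test.ne (e f : NatExpr) : Test := .not (.eq e f)

/-- Whether one number is less than another. -/
def Test.lt (e f : NatExpr) : Test := .not (.natLe f e)

@[simp] theorem Test.holds_or (m : Memory) (t u : Test) :
    (Test.or t u).Holds m ↔ t.Holds m ∨ u.Holds m := by
  simp only [Test.or, Holds]; tauto

@[simp] theorem Test.holds_ne (m : Memory) (e f : NatExpr) :
    (Test.ne e f).Holds m ↔ e.eval m ≠ f.eval m := by
  simp only [Test.ne, Holds, holds_eq, Ne]

@[simp] theorem Test.holds_lt (m : Memory) (e f : NatExpr) :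
    (Test.lt e f).Holds m ↔ e.eval m < f.eval m := not_le

/-- The label of the community that a counter points to. -/
abbrev labelOf (k : ℕ) : NatExpr := .cell 23 (.var k) (.const 0)

/-- Whether the counters point to a pair in a relation stored in an array. -/
abbrev rel (a k l : ℕ) : Test := .pos a (.var k) (.var l)

/-- The counters `k` and `l` point to different numbers. -/
abbrev distinct (k l : ℕ) : Test := .ne (.var k) (.var l)

/-- The first cell of a real array. -/
abbrev RealExpr.var (k : ℕ) : RealExpr := .cell k (.const 0) (.const 0)

/-- The cost of the center to which `k` points, for the label in the counter `10`. -/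
abbrev centerCost (k : ℕ) : RealExpr := .cell 40 (.var 10) (.var k)

/-- The counters `12` and `13` point to different vertices of both communities in the counters
`10` and `11`, and the second one is not covered in the first community. -/
abbrev sharedTest : Test :=
  .and (distinct 12 13) (.and (rel 5 10 12) (.and (rel 5 11 12) (.and (rel 5 10 13)
    (.and (rel 5 11 13) (.not (rel 20 10 13))))))

/-- The counter `11` points to a vertex that cannot be the center of the community in the counter
`10`, as the vertex in the counter `12` or the community in the counter `13` shows. -/
abbrev badTest : Test :=
  .or (.not (rel 5 10 11)) (.or (.and (rel 5 10 12) (.and (distinct 12 11) (.not (rel 4 11 12))))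
    (.or (.and (rel 20 10 12) (.and (distinct 12 11) (.not (rel 6 11 12))))
      (.and (rel 21 10 13) (.not (rel 5 13 11)))))

/-- The vertex in the counter `k` is the best center for the label in the counter `10`. -/
abbrev chosenTest (k : ℕ) : Test := .and (.not (rel 25 10 k)) (.not (rel 26 10 k))

/-- The counters `k` and `l` point to an edge of the selected graph. -/
abbrev edgeTest (k l : ℕ) : Test := .or (rel 29 k l) (rel 6 k l)

/-- The main part of the algorithm. It stores the covered vertices (array `20`), linked (`21`) and
tied (`22`) communities, labels (`23`), the vertices for each label (`24`), inadmissible centers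
(`25`) and their costs (real array `40`), centers that are not the best ones (`26`), labels with
an admissible center (`27`), failure (`28`), edges of stars (`29`), their number (`33`), their
weight (real array `41`) and whether they form a solution (`34`). -/
def commands : List Command :=
  [.mark [(10, true), (11, false), (12, false)]
      (.and (rel 5 10 11) (.and (rel 5 10 12) (rel 6 12 11))) 20 (.var 10) (.var 11),
    .mark [(10, true), (11, true), (12, false), (13, false)] sharedTest 21 (.var 10) (.var 11),
    .mark [(10, true), (11, true), (12, false), (13, false), (14, false)]
      (.and sharedTest (.and (distinct 14 12) (.and (distinct 14 13)
        (.and (rel 5 10 14) (rel 5 11 14))))) 22 (.var 10) (.var 11),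
    .initLabels,
    .mergeTied,
    .mark [(10, true), (11, false)] (rel 5 10 11) 24 (labelOf 10) (.var 11),
    .mark [(10, true), (11, false), (12, false), (13, true)] badTest 25 (labelOf 10) (.var 11),
    .total [(10, true), (11, false), (12, false)]
      (.and (rel 24 10 12) (.and (distinct 12 11) (.not (rel 6 11 12)))) 40 (.var 10) (.var 11)
      (.cell 1 (.var 11) (.var 12)),
    .mark [(10, true), (11, false), (12, false)]
      (.and (.not (rel 25 10 12)) (.or (.not (.realLe (centerCost 11) (centerCost 12)))
        (.and (.realLe (centerCost 12) (centerCost 11)) (.lt (.var 12) (.var 11)))))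
      26 (.var 10) (.var 11),
    .mark [(10, true), (11, false)] (.not (rel 25 10 11)) 27 (.var 10) (.const 0),
    .mark [(10, true)] (.not (.pos 27 (labelOf 10) (.const 0))) 28 (.const 0) (.const 0),
    .mark [(10, true), (11, false), (12, false)]
      (.and (distinct 11 12) (.or (.and (chosenTest 11) (rel 24 10 12))
        (.and (chosenTest 12) (rel 24 10 11)))) 29 (.var 11) (.var 12),
    .count [(10, false), (11, false)] (.and (.lt (.var 10) (.var 11)) (edgeTest 10 11))
      33 (.const 0) (.const 0),
    .total [(10, false), (11, false)] (.and (.lt (.var 10) (.var 11)) (edgeTest 10 11))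
      41 (.const 0) (.const 0) (.cell 1 (.var 10) (.var 11)),
    .mark [] (.and (.not (.pos 28 (.const 0) (.const 0)))
      (.and (.natLe (.add (.var 33) (.var 3)) (.var 2)) (.realLe (.var 41) (.var 0))))
      34 (.const 0) (.const 0)]

/-- Write the selected edges to array `1`. -/
def outputEdges : Command :=
  .mark [(10, false), (11, false)] (edgeTest 10 11) 1 (.var 10) (.var 11)

theorem exists_lt_iff_fin {N : ℕ} {p : ℕ → Prop} : (∃ v < N, p v) ↔ ∃ v : Fin N, p v :=
  ⟨fun ⟨v, hv, h⟩ => ⟨⟨v, hv⟩, h⟩, fun ⟨v, h⟩ => ⟨v, v.2, h⟩⟩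

/-! ### Reading the arrays in the final memory -/

section Equations

variable (m : Memory)

/-- The memory after the main part of the algorithm. -/
def final : Memory := (Command.block commands).run m

/-- The cells that the algorithm takes to be `0`. -/
def Clean : Prop :=
  ∀ a, 20 ≤ a → a ≠ 30 → ∀ i j, m.nat (a, i, j) = 0 ∧ m.real (a, i, j) = 0

variable {m}

theorem final_mark {pre post : List Command} {ks : List (ℕ × Bool)} {t : Test} {B : ℕ}
    {i j : NatExpr} (hl : commands = pre ++ .mark ks t B i j :: post)
    (h : wellPlaced pre ks t B i j post) (hm : Clean m) (hB : 20 ≤ B ∧ B ≠ 30) (p q : ℕ) :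
    1 ≤ (final m).nat (B, p, q) ↔
      ExistsLoops ks (fun m => t.Holds m ∧ p = i.eval m ∧ q = j.eval m) (final m) :=
  pos_mark hl h (hm B hB.1 hB.2 p q).1

theorem Command.run_frame_of_wf {C : Command} (h : C.wf) (m : Memory) {a : ℕ}
    (ht : a ∉ C.targets) (ha : isCounter a = false) (i j : ℕ) :
    (C.run m).nat (a, i, j) = m.nat (a, i, j) ∧ (C.run m).real (a, i, j) = m.real (a, i, j) := by
  refine Command.run_frame _ m ht (fun h' => ?_) i j
  have := isCounter_of_mem_counters h h'
  simp [ha] at this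

theorem final_frame {a : ℕ} (ha : a < 10 ∨ a = 30) (i j : ℕ) :
    (final m).nat (a, i, j) = m.nat (a, i, j) ∧ (final m).real (a, i, j) = m.real (a, i, j) := by
  have h1 : (Command.block commands).targets =
      [20, 21, 22, 23, 31, 32, 23, 24, 25, 40, 26, 27, 28, 29, 33, 41, 34] := rfl
  refine Command.run_frame_of_wf (C := .block commands) rfl m ?_ ?_ i j
  · rw [h1]
    simp only [List.mem_cons, List.not_mem_nil, or_false, not_or]
    omega
  · simp only [isCounter, Bool.and_eq_false_iff, decide_eq_false_iff_not]
    omega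

/-- Array `22` is complete after three commands and array `23` after five; later commands write
neither, so the facts about merging carry over. -/
theorem final_labels :
    (∀ i < (final m).nat (30, 0, 0), (final m).nat (23, i, 0) < (final m).nat (30, 0, 0)) ∧
    (∀ i < (final m).nat (30, 0, 0), ∀ j < (final m).nat (30, 0, 0),
      1 ≤ (final m).nat (22, i, j) → (final m).nat (23, i, 0) = (final m).nat (23, j, 0)) ∧
    ∀ g : ℕ → ℕ, (∀ i < (final m).nat (30, 0, 0), ∀ j < (final m).nat (30, 0, 0),
        1 ≤ (final m).nat (22, i, j) → g i = g j) →
      ∀ i < (final m).nat (30, 0, 0), ∀ j < (final m).nat (30, 0, 0),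
        (final m).nat (23, i, 0) = (final m).nat (23, j, 0) → g i = g j := by
  have h := run_labels ((Command.block (commands.take 3)).run m)
  have h30 : (final m).nat (30, 0, 0) = ((Command.block (commands.take 3)).run m).nat (30, 0, 0) :=
    (Command.run_frame_of_wf (C := .block (commands.drop 3)) rfl _ (by decide) rfl 0 0).1
  have h22 : ∀ i j, (final m).nat (22, i, j) =
      ((Command.block (commands.take 3)).run m).nat (22, i, j) := fun i j =>
    (Command.run_frame_of_wf (C := .block (commands.drop 3)) rfl _ (by decide) rfl i j).1
  have h23 : ∀ i, (final m).nat (23, i, 0) = (Command.mergeTied.run (Command.initLabels.run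
      ((Command.block (commands.take 3)).run m))).nat (23, i, 0) := fun i =>
    (Command.run_frame_of_wf (C := .block (commands.drop 5)) rfl _ (by decide) rfl i 0).1
  simp only [h30, h22, h23]
  exact h

end Equations

/-! ### Correctness -/

/-- The memory on which the main part of the algorithm is started. -/
def start (I : Instance n c) (Es : Finset (Sym2 (Fin n))) : Memory :=
  { I.input Es with
    nat := Function.update (Function.update (I.input Es).nat (30, 0, 0) c) (1, 0, 0) 0 }

section Correctness

variable (I : Instance n c) (Es : Finset (Sym2 (Fin n)))

theorem start_nat (a i j : ℕ) : (start I Es).nat (a, i, j) =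
    if a = 1 ∧ i = 0 ∧ j = 0 then 0 else if a = 30 ∧ i = 0 ∧ j = 0 then c
      else (I.input Es).nat (a, i, j) := by
  simp [start, Function.update_apply]

theorem start_clean : Clean (start I Es) := by
  intro a h1 h2 i j
  refine ⟨?_, ?_⟩
  · rw [start_nat, if_neg (by omega), if_neg (by omega)]
    simp only [Instance.input]
    split <;> first | rfl | (simp_all; try omega)
  · simp only [start, Instance.input]
    split <;> first | rfl | (simp_all; try omega)

theorem final_sizeFalse : (final (start I Es)).nat (0, 0, 0) = n := by
  rw [(final_frame (by norm_num) 0 0).1, start_nat]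
  simp [Instance.input]

theorem final_sizeTrue : (final (start I Es)).nat (30, 0, 0) = c := by
  rw [(final_frame (by norm_num) 0 0).1, start_nat]
  simp

theorem final_two : (final (start I Es)).nat (2, 0, 0) = I.ell.toNat := by
  rw [(final_frame (by norm_num) 0 0).1, start_nat]
  simp [Instance.input]

theorem final_three : (final (start I Es)).nat (3, 0, 0) = (-I.ell).toNat := by
  rw [(final_frame (by norm_num) 0 0).1, start_nat]
  simp [Instance.input]

theorem final_graph (u v : Fin n) :
    1 ≤ (final (start I Es)).nat (4, u, v) ↔ I.graph.Adj u v := by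
  rw [(final_frame (by norm_num) _ _).1, start_nat]
  simp only [Instance.input]
  split_ifs <;> simp_all [Fin.val_inj]

theorem final_community (i : Fin c) (v : Fin n) :
    1 ≤ (final (start I Es)).nat (5, i, v) ↔ v ∈ I.community i := by
  rw [(final_frame (by norm_num) _ _).1, start_nat]
  simp only [Instance.input]
  split_ifs <;> simp_all [Fin.val_inj]

theorem final_edges (u v : Fin n) :
    1 ≤ (final (start I Es)).nat (6, u, v) ↔ s(u, v) ∈ Es := by
  rw [(final_frame (by norm_num) _ _).1, start_nat]
  simp only [Instance.input]
  split_ifs <;> simp_all [Fin.val_inj]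

theorem final_bound : (final (start I Es)).real (0, 0, 0) = I.b := by
  rw [(final_frame (by norm_num) 0 0).2]
  rfl

theorem final_weight (u v : Fin n) :
    (final (start I Es)).real (1, u, v) = edgeWeight I s(u, v) := by
  rw [(final_frame (by norm_num) _ _).2]
  by_cases h : I.graph.Adj u v <;> simp [start, Instance.input, edgeWeight, h]

theorem final_covered (i : Fin c) (w : Fin n) :
    1 ≤ (final (start I Es)).nat (20, i, w) ↔ Covered I Es i w := by
  rw [final_mark (pre := commands.take 0) (post := commands.drop 1) rfl rfl (start_clean I Es)
    (by norm_num)]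
  simp only [ExistsLoops, Test.Holds, Test.holds_pos, NatExpr.eval, Memory.upd_nat,
    Nat.reduceEqDiff, false_and, and_self, if_true, if_false, sizeArray, Bool.false_eq_true,
    OfNat.zero_ne_ofNat, final_sizeFalse, final_sizeTrue, exists_lt_iff_fin, final_community,
    final_edges, Fin.val_inj]
  constructor
  · rintro ⟨_, _, u, ⟨h1, h2, h3⟩, rfl, rfl⟩
    exact ⟨h1, u, h2, h3⟩
  · rintro ⟨h1, u, h2, h3⟩
    exact ⟨i, w, u, ⟨h1, h2, h3⟩, rfl, rfl⟩

theorem final_linked (i j : Fin c) :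
    1 ≤ (final (start I Es)).nat (21, i, j) ↔ Linked I Es i j := by
  rw [final_mark (pre := commands.take 1) (post := commands.drop 2) rfl rfl (start_clean I Es)
    (by norm_num)]
  simp only [ExistsLoops, Test.Holds, Test.holds_pos, Test.holds_ne, NatExpr.eval,
    Memory.upd_nat, Nat.reduceEqDiff, false_and, and_self, if_true, if_false, sizeArray,
    Bool.false_eq_true, OfNat.zero_ne_ofNat, final_sizeFalse, final_sizeTrue, exists_lt_iff_fin,
    final_community, final_covered, Fin.val_inj, ne_eq]
  constructor
  · rintro ⟨_, _, u, v, ⟨h1, h2, h3, h4, h5, h6⟩, rfl, rfl⟩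
    exact ⟨u, v, h1, h2, h3, h4, h5, h6⟩
  · rintro ⟨u, v, h1, h2, h3, h4, h5, h6⟩
    exact ⟨i, j, u, v, ⟨h1, h2, h3, h4, h5, h6⟩, rfl, rfl⟩

theorem final_tied (i j : Fin c) :
    1 ≤ (final (start I Es)).nat (22, i, j) ↔ Tied I Es i j := by
  rw [final_mark (pre := commands.take 2) (post := commands.drop 3) rfl rfl (start_clean I Es)
    (by norm_num)]
  simp only [ExistsLoops, Test.Holds, Test.holds_pos, Test.holds_ne, NatExpr.eval,
    Memory.upd_nat, Nat.reduceEqDiff, false_and, and_self, if_true, if_false, sizeArray,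
    Bool.false_eq_true, OfNat.zero_ne_ofNat, final_sizeFalse, final_sizeTrue, exists_lt_iff_fin,
    final_community, final_covered, Fin.val_inj, ne_eq]
  constructor
  · rintro ⟨_, _, u, v, w, ⟨⟨h1, h2, h3, h4, h5, h6⟩, h7, h8, h9, h10⟩, rfl, rfl⟩
    exact ⟨u, v, w, h1, h7, h8, h2, h3, h4, h5, h9, h10, h6⟩
  · rintro ⟨u, v, w, h1, h7, h8, h2, h3, h4, h5, h9, h10, h6⟩
    exact ⟨i, j, u, v, w, ⟨⟨h1, h2, h3, h4, h5, h6⟩, h7, h8, h9, h10⟩, rfl, rfl⟩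

/-- The labels that the algorithm computes. -/
theorem exists_labels : ∃ lab : Fin c → Fin c,
    (∀ i : Fin c, (final (start I Es)).nat (23, i, 0) = lab i) ∧
    (∀ i j, Tied I Es i j → lab i = lab j) ∧
    ∀ g : Fin c → Fin n, (∀ i j, Tied I Es i j → g i = g j) →
      ∀ i j, lab i = lab j → g i = g j := by
  obtain ⟨h1, h2, h3⟩ := final_labels (m := start I Es)
  simp only [final_sizeTrue] at h1 h2 h3
  refine ⟨fun i => ⟨_, h1 i i.2⟩, fun i => rfl, fun i j hij => ?_, fun g hg i j hij => ?_⟩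
  · exact Fin.ext (h2 i i.2 j j.2 ((final_tied I Es i j).2 hij))
  -- The merging loops know only natural numbers; the value `0` beyond `c` is never consulted.
  · have := h3 (fun k => if hk : k < c then g ⟨k, hk⟩ else 0) (fun i hi j hj hij => by
      simp only [dif_pos hi, dif_pos hj]
      rw [hg ⟨i, hi⟩ ⟨j, hj⟩ ((final_tied I Es ⟨i, hi⟩ ⟨j, hj⟩).1 hij)]) i i.2 j j.2
      (Fin.val_eq_of_eq hij)
    simpa [Fin.val_inj] using this

variable {lab : Fin c → Fin c}

theorem final_classUnion
    (hlab : ∀ i : Fin c, (final (start I Es)).nat (23, i, 0) = lab i)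
    (l : Fin c) (w : Fin n) :
    1 ≤ (final (start I Es)).nat (24, l, w) ↔ w ∈ classUnion I lab l := by
  rw [final_mark (pre := commands.take 5) (post := commands.drop 6) rfl rfl (start_clean I Es)
    (by norm_num)]
  simp only [ExistsLoops, Test.holds_pos, NatExpr.eval, Memory.upd_nat,
    Nat.reduceEqDiff, false_and, and_self, if_true, if_false, sizeArray, Bool.false_eq_true,
    OfNat.zero_ne_ofNat, final_sizeFalse, final_sizeTrue, exists_lt_iff_fin, final_community,
    hlab, Fin.val_inj, classUnion, Finset.mem_filter, Finset.mem_univ, true_and]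
  constructor
  · rintro ⟨i, _, h, rfl, rfl⟩
    exact ⟨i, rfl, h⟩
  · rintro ⟨i, rfl, h⟩
    exact ⟨i, w, h, rfl, rfl⟩

theorem final_admissible
    (hlab : ∀ i : Fin c, (final (start I Es)).nat (23, i, 0) = lab i)
    (l : Fin c) (x : Fin n) :
    1 ≤ (final (start I Es)).nat (25, l, x) ↔ ¬ ClassAdmissible I Es lab l x := by
  rw [final_mark (pre := commands.take 6) (post := commands.drop 7) rfl rfl (start_clean I Es)
    (by norm_num)]
  simp only [ExistsLoops, Test.Holds, Test.holds_pos, Test.holds_ne, Test.holds_or, NatExpr.eval,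
    Memory.upd_nat, Nat.reduceEqDiff, false_and, and_self, if_true, if_false, sizeArray,
    Bool.false_eq_true, OfNat.zero_ne_ofNat, final_sizeFalse, final_sizeTrue, exists_lt_iff_fin,
    final_community, final_covered, final_graph, final_edges, final_linked, hlab, Fin.val_inj,
    ne_eq]
  rw [ClassAdmissible]
  push Not
  constructor
  · rintro ⟨i, _, w, j, h, rfl, rfl⟩
    refine ⟨i, rfl, fun h' => ?_⟩
    obtain ⟨h1, h2, h3, h4⟩ := h'
    rcases h with h | ⟨h, h5, h6⟩ | ⟨h, h5, h6⟩ | ⟨h, h5⟩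
    · exact h h1
    · exact h6 (h2 w h h5)
    · exact h6 (h3 w h h5)
    · exact h5 (h4 j h)
  · rintro ⟨i, rfl, h⟩
    by_contra hcon
    push Not at hcon
    refine h ⟨?_, fun w hw hwx => ?_, fun w hw hwx => ?_, fun j hj => ?_⟩ <;> by_contra h'
    -- One loop nest tests all four defects, so the counters that a defect does not use need dummy
    -- values, here `x` and `i`.
    · exact hcon i x x i (.inl h') rfl rfl
    · exact hcon i x w i (.inr (.inl ⟨hw, hwx, h'⟩)) rfl rfl
    · exact hcon i x w i (.inr (.inr (.inl ⟨hw, hwx, h'⟩))) rfl rfl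
    · exact hcon i x x j (.inr (.inr (.inr ⟨hj, h'⟩))) rfl rfl

end Correctness

/-- A set without loops meets each edge in exactly one ordered pair with `u < v`, which is how the
counting and summing loops visit it. -/
theorem sum_pairs {M : Type*} [AddCommMonoid M] {E : Finset (Sym2 (Fin n))}
    (hE : ∀ u, s(u, u) ∉ E) (f : Sym2 (Fin n) → M) [∀ u v : Fin n, Decidable (u < v ∧ s(u, v) ∈ E)] :
    ∑ u, ∑ v, (if u < v ∧ s(u, v) ∈ E then f s(u, v) else 0) = ∑ e ∈ E, f e := by
  rw [← Finset.sum_product', ← Finset.sum_filter]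
  refine Finset.sum_bij (fun p _ => s(p.1, p.2)) ?_ ?_ ?_ ?_
  · intro p hp
    exact (Finset.mem_filter.1 hp).2.2
  · rintro ⟨a, b⟩ hp ⟨a', b'⟩ hq h
    have h1 := (Finset.mem_filter.1 hp).2.1
    have h2 := (Finset.mem_filter.1 hq).2.1
    simp only [Sym2.eq_iff] at h h1 h2
    rcases h with ⟨rfl, rfl⟩ | ⟨rfl, rfl⟩
    · rfl
    · exact absurd h1 h2.asymm
  · intro e he
    induction e using Sym2.ind with
    | _ a b =>
      rcases lt_trichotomy a b with h | rfl | h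
      · exact ⟨(a, b), Finset.mem_filter.2 ⟨by simp, h, he⟩, rfl⟩
      · exact absurd he (hE a)
      · refine ⟨(b, a), Finset.mem_filter.2 ⟨by simp, h, ?_⟩, Sym2.eq_swap⟩
        rw [Sym2.eq_swap]; exact he
  · exact fun _ _ => rfl

/-! ### Costs, best centers and the selected graph -/

section Correctness

variable (I : Instance n c) (Es : Finset (Sym2 (Fin n))) {lab : Fin c → Fin c}

theorem final_cost
    (hlab : ∀ i : Fin c, (final (start I Es)).nat (23, i, 0) = lab i)
    (l : Fin c) (x : Fin n) : (final (start I Es)).real (40, l, x) =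
      ∑ w ∈ fresh I Es lab l x, edgeWeight I s(x, w) := by
  refine (real_total (l := commands) (pre := commands.take 7) (post := commands.drop 8) rfl rfl rfl
    (start_clean I Es 40 (by norm_num) (by norm_num) l x).2).trans ?_
  rw [show (Command.block commands).run (start I Es) = final (start I Es) from rfl]
  simp only [sumLoops, Test.Holds, Test.holds_pos, Test.holds_ne, NatExpr.eval, RealExpr.eval,
    Memory.upd_nat, Memory.upd_real, Nat.reduceEqDiff, false_and, and_self, if_true, if_false,
    sizeArray, Bool.false_eq_true, OfNat.zero_ne_ofNat, final_sizeFalse, final_sizeTrue,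
    Finset.sum_range, final_edges, final_weight, final_classUnion I Es hlab, Fin.val_inj, ne_eq]
  -- The loops run over all labels and centers, but only the ones that address this cell contribute.
  rw [Finset.sum_eq_single l, Finset.sum_eq_single x, fresh, Finset.sum_filter,
    ← Finset.sum_filter_add_sum_filter_not Finset.univ (· ∈ classUnion I lab l)]
  · rw [Finset.sum_eq_zero (s := Finset.univ.filter (· ∉ classUnion I lab l)), add_zero]
    · refine Finset.sum_congr (by ext; simp) fun w hw => ?_
      have hw' : w ∈ classUnion I lab l := hw
      simp [hw']
    · intro w hw
      have hw' : w ∉ classUnion I lab l := by simpa using hw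
      simp [hw']
  · intro y _ hy
    simp [Ne.symm hy]
  · simp
  · intro k _ hk
    simp [Ne.symm hk]
  · simp

/-- The least center among the admissible ones of least cost. -/
def IsBest (lab : Fin c → Fin c) (l : Fin c) (x : Fin n) : Prop :=
  ClassAdmissible I Es lab l x ∧ ∀ y, ClassAdmissible I Es lab l y →
    ∑ w ∈ fresh I Es lab l x, edgeWeight I s(x, w) <
      ∑ w ∈ fresh I Es lab l y, edgeWeight I s(y, w) ∨
    ∑ w ∈ fresh I Es lab l x, edgeWeight I s(x, w) ≤
      ∑ w ∈ fresh I Es lab l y, edgeWeight I s(y, w) ∧ x ≤ y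

variable {I Es} in
-- The program tests all vertices instead of storing a center; uniqueness ensures that the edges it
-- marks come from the single center `z l` of each label.
theorem IsBest.unique {l : Fin c} {x y : Fin n} (hx : IsBest I Es lab l x)
    (hy : IsBest I Es lab l y) : x = y := by
  rcases hx.2 y hy.1 with h | h <;> rcases hy.2 x hx.1 with h' | h'
  · exact absurd h h'.asymm
  · exact absurd h h'.1.not_gt
  · exact absurd h' h.1.not_gt
  · exact le_antisymm h.2 h'.2

variable {I Es} in
theorem exists_isBest {l : Fin c} (h : ∃ x, ClassAdmissible I Es lab l x) :
    ∃ x, IsBest I Es lab l x := by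
  classical
  obtain ⟨x₀, hx₀⟩ := h
  obtain ⟨x, hx, hmin⟩ := Finset.exists_min_image
    (Finset.univ.filter fun x => ClassAdmissible I Es lab l x)
    -- The lexicographic order breaks ties between equal costs by the number of the vertex.
    (fun x => toLex (∑ w ∈ fresh I Es lab l x, edgeWeight I s(x, w), x)) ⟨x₀, by simpa using hx₀⟩
  refine ⟨x, by simpa using hx, fun y hy => ?_⟩
  rcases Prod.Lex.toLex_le_toLex.1 (hmin y (by simpa using hy)) with h | h
  · exact .inl h
  · exact .inr ⟨h.1.le, h.2⟩

theorem final_beaten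
    (hlab : ∀ i : Fin c, (final (start I Es)).nat (23, i, 0) = lab i)
    (l : Fin c) (x : Fin n) : (¬ 1 ≤ (final (start I Es)).nat (25, l, x) ∧
      ¬ 1 ≤ (final (start I Es)).nat (26, l, x)) ↔ IsBest I Es lab l x := by
  rw [final_mark (pre := commands.take 8) (post := commands.drop 9) rfl rfl (start_clean I Es)
    (by norm_num)]
  simp only [ExistsLoops, Test.Holds, Test.holds_pos, Test.holds_lt, Test.holds_or, NatExpr.eval,
    RealExpr.eval, Memory.upd_real,
    Memory.upd_nat, Nat.reduceEqDiff, false_and, and_self, if_true, if_false, sizeArray,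
    Bool.false_eq_true, OfNat.zero_ne_ofNat, final_sizeFalse, final_sizeTrue, exists_lt_iff_fin,
    final_admissible I Es hlab, final_cost I Es hlab, Fin.val_inj, Fin.val_fin_lt, not_not]
  rw [IsBest]
  refine and_congr_right fun _ => ⟨fun h y hy => ?_, ?_⟩
  · by_contra hcon
    rw [not_or, not_and_or, not_lt, not_le] at hcon
    refine h ⟨l, x, y, ⟨hy, ?_⟩, rfl, rfl⟩
    rcases hcon.2 with h' | h'
    · exact .inl (not_le.2 h')
    · exact .inr ⟨hcon.1, not_le.1 h'⟩
  · rintro h ⟨_, _, y, ⟨hy, h'⟩, rfl, rfl⟩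
    rcases h y hy with h1 | h1 <;> rcases h' with h2 | h2
    · exact h2 h1.le
    · exact absurd h1 h2.1.not_gt
    · exact h2 h1.1
    · exact absurd h2.2 h1.2.not_gt

theorem final_failure
    (hlab : ∀ i : Fin c, (final (start I Es)).nat (23, i, 0) = lab i) :
    1 ≤ (final (start I Es)).nat (28, 0, 0) ↔
      ∃ i, ∀ x, ¬ ClassAdmissible I Es lab (lab i) x := by
  have h27 : ∀ l : Fin c, 1 ≤ (final (start I Es)).nat (27, l, 0) ↔
      ∃ x, ClassAdmissible I Es lab l x := by
    intro l
    rw [final_mark (pre := commands.take 9) (post := commands.drop 10) rfl rfl (start_clean I Es)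
      (by norm_num)]
    simp only [ExistsLoops, Test.Holds, Test.holds_pos, NatExpr.eval, Memory.upd_nat,
      Nat.reduceEqDiff, false_and, and_self, if_true, if_false, sizeArray, Bool.false_eq_true,
      OfNat.zero_ne_ofNat, final_sizeFalse, final_sizeTrue, exists_lt_iff_fin,
      final_admissible I Es hlab, Fin.val_inj, not_not, and_true]
    constructor
    · rintro ⟨_, x, h, rfl⟩
      exact ⟨x, h⟩
    · rintro ⟨x, h⟩
      exact ⟨l, x, h, rfl⟩
  rw [final_mark (pre := commands.take 10) (post := commands.drop 11) rfl rfl (start_clean I Es)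
    (by norm_num)]
  simp only [ExistsLoops, Test.Holds, Test.holds_pos, NatExpr.eval, Memory.upd_nat,
    Nat.reduceEqDiff, false_and, and_self, if_true, if_false, sizeArray,
    final_sizeTrue, exists_lt_iff_fin, hlab, h27, and_true, not_exists]

variable {z : Fin c → Fin n}

/-- Array `29` holds whole stars, including their edges in `Es`; the difference from `freshEdges`
disappears in the union with `Es`. -/
theorem final_selected
    (hlab : ∀ i : Fin c, (final (start I Es)).nat (23, i, 0) = lab i)
    (hz : ∀ l, IsBest I Es lab l (z l)) (u v : Fin n) :
    (1 ≤ (final (start I Es)).nat (29, u, v) ∨ 1 ≤ (final (start I Es)).nat (6, u, v)) ↔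
      s(u, v) ∈ selected I Es lab z := by
  rw [final_mark (pre := commands.take 11) (post := commands.drop 12) rfl rfl (start_clean I Es)
    (by norm_num)]
  simp only [ExistsLoops, Test.Holds, Test.holds_pos, Test.holds_ne, Test.holds_or, NatExpr.eval,
    Memory.upd_nat, Nat.reduceEqDiff, false_and, and_self, if_true, if_false, sizeArray,
    Bool.false_eq_true, OfNat.zero_ne_ofNat, final_sizeFalse, final_sizeTrue, exists_lt_iff_fin,
    final_beaten I Es hlab, final_classUnion I Es hlab, final_edges, Fin.val_inj, ne_eq]
  rw [selected, Finset.mem_union, Finset.mem_biUnion]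
  have key : ∀ l (a b : Fin n), a ≠ b → IsBest I Es lab l a → b ∈ classUnion I lab l →
      s(a, b) ∈ Es ∨ ∃ l ∈ Finset.univ.image lab, s(a, b) ∈ freshEdges I Es lab l (z l) := by
    intro l a b hab ha hb
    by_cases he : s(a, b) ∈ Es
    · exact .inl he
    obtain rfl := ha.unique (hz l)
    simp only [classUnion, Finset.mem_filter, Finset.mem_univ, true_and] at hb
    obtain ⟨i, rfl, hb⟩ := hb
    exact .inr ⟨lab i, by simp, mem_freshEdges.2 ⟨b, i, rfl, hb, hab.symm, he, rfl⟩⟩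
  constructor
  · rintro (⟨l, _, _, ⟨huv, h⟩, rfl, rfl⟩ | h)
    · rcases h with ⟨h1, h2⟩ | ⟨h1, h2⟩
      · exact key l u v huv h1 h2
      · rw [Sym2.eq_swap]
        exact key l v u (Ne.symm huv) h1 h2
    · exact .inl h
  · rintro (h | ⟨l, -, h⟩)
    · exact .inr h
    · obtain ⟨w, i, hi, hw, hwx, -, he⟩ := mem_freshEdges.1 h
      have hw' : w ∈ classUnion I lab l := by
        simp only [classUnion, Finset.mem_filter, Finset.mem_univ, true_and]
        exact ⟨i, hi, hw⟩
      rcases Sym2.eq_iff.1 he with ⟨rfl, rfl⟩ | ⟨rfl, rfl⟩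
      · exact .inl ⟨l, _, _, ⟨Ne.symm hwx, .inl ⟨hz l, hw'⟩⟩, rfl, rfl⟩
      · exact .inl ⟨l, _, _, ⟨hwx, .inr ⟨hz l, hw'⟩⟩, rfl, rfl⟩

theorem loop_notMem_selected {lab : Fin c → Fin c} (hEs : ∀ e ∈ Es, e ∈ I.graph.edgeSet)
    (hz : ∀ l, IsBest I Es lab l (z l)) (u : Fin n) : s(u, u) ∉ selected I Es lab z := by
  intro h
  have := mem_edgeSet_of_mem_selected hEs (fun i => (hz (lab i)).1 i rfl) h
  exact I.graph.irrefl ((SimpleGraph.mem_edgeSet _).1 this)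

theorem final_card
    (hlab : ∀ i : Fin c, (final (start I Es)).nat (23, i, 0) = lab i)
    (hEs : ∀ e ∈ Es, e ∈ I.graph.edgeSet) (hz : ∀ l, IsBest I Es lab l (z l)) :
    (final (start I Es)).nat (33, 0, 0) = (selected I Es lab z).card := by
  refine (nat_count (l := commands) (pre := commands.take 12) (post := commands.drop 13) rfl rfl
    (start_clean I Es 33 (by norm_num) (by norm_num) 0 0).1).trans ?_
  rw [show (Command.block commands).run (start I Es) = final (start I Es) from rfl,
    Finset.card_eq_sum_ones, ← sum_pairs (loop_notMem_selected I Es hEs hz)]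
  simp only [sumLoops, Test.holds_pos, Test.holds_lt, Test.holds_or, Test.Holds, NatExpr.eval,
    Memory.upd_nat, Nat.reduceEqDiff, false_and, and_self, if_true, if_false, sizeArray,
    Bool.false_eq_true, OfNat.zero_ne_ofNat, final_sizeFalse, Finset.sum_range,
    final_selected I Es hlab hz, Fin.val_fin_lt, and_true]

theorem final_total
    (hlab : ∀ i : Fin c, (final (start I Es)).nat (23, i, 0) = lab i)
    (hEs : ∀ e ∈ Es, e ∈ I.graph.edgeSet) (hz : ∀ l, IsBest I Es lab l (z l)) :
    (final (start I Es)).real (41, 0, 0) = ∑ e ∈ selected I Es lab z, I.weight e := by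
  refine (real_total (l := commands) (pre := commands.take 13) (post := commands.drop 14) rfl rfl
    rfl (start_clean I Es 41 (by norm_num) (by norm_num) 0 0).2).trans ?_
  rw [show (Command.block commands).run (start I Es) = final (start I Es) from rfl,
    ← sum_edgeWeight fun e he => mem_edgeSet_of_mem_selected hEs (fun i => (hz (lab i)).1 i rfl) he,
    ← sum_pairs (loop_notMem_selected I Es hEs hz)]
  simp only [sumLoops, Test.holds_pos, Test.holds_lt, Test.holds_or, Test.Holds, NatExpr.eval,
    RealExpr.eval, Memory.upd_real, final_weight,
    Memory.upd_nat, Nat.reduceEqDiff, false_and, and_self, if_true, if_false, sizeArray,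
    Bool.false_eq_true, OfNat.zero_ne_ofNat, final_sizeFalse, Finset.sum_range,
    final_selected I Es hlab hz, Fin.val_fin_lt, and_true]

theorem final_ok : 1 ≤ (final (start I Es)).nat (34, 0, 0) ↔
    ¬ 1 ≤ (final (start I Es)).nat (28, 0, 0) ∧
      ((final (start I Es)).nat (33, 0, 0) : ℤ) ≤ I.ell ∧
      (final (start I Es)).real (41, 0, 0) ≤ I.b := by
  rw [final_mark (pre := commands.take 14) (post := commands.drop 15) rfl rfl (start_clean I Es)
    (by norm_num)]
  simp only [ExistsLoops, Test.Holds, Test.holds_pos, NatExpr.eval, RealExpr.eval, final_two,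
    final_three, final_bound, and_true]
  refine and_congr_right fun _ => and_congr_left fun _ => ?_
  -- The integer `ℓ` is stored as positive and negative part, so the test compares the number of
  -- edges plus `max (-ℓ) 0` with `max ℓ 0`.
  omega

end Correctness

/-- The algorithm. -/
def algorithm : Program :=
  .seq (.setNat 30 (.const 0) (.const 0) (.var 1))
    (.seq (.setNat 1 (.const 0) (.const 0) (.const 0))
      (.seq (Command.block commands).compile
        (.seq outputEdges.compile
          (.branch (.pos 34 (.const 0) (.const 0))
            (.setNat 0 (.const 0) (.const 0) (.const 1))
            (.setNat 0 (.const 0) (.const 0) (.const 0))))))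

/-- A bound for the running time of the algorithm. -/
def timeBound : ℕ[X] := (Command.block commands).cost + outputEdges.cost + 19

/-! ### Halting, running time and output -/

section Correctness

variable (I : Instance n c) (Es : Finset (Sym2 (Fin n)))

open Classical in
/-- The memory in which the algorithm halts. -/
def result : Memory :=
  { outputEdges.run (final (start I Es)) with
    nat := Function.update (outputEdges.run (final (start I Es))).nat (0, 0, 0)
      (if 1 ≤ (final (start I Es)).nat (34, 0, 0) then 1 else 0) }

theorem output_frame {a : ℕ} (ha : a ≠ 1) (ha' : isCounter a = false) (m : Memory) (i j : ℕ) :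
    (outputEdges.run m).nat (a, i, j) = m.nat (a, i, j) :=
  (Command.run_frame_of_wf (C := outputEdges) rfl m
    (by rw [show outputEdges.targets = [1] from rfl]; simpa using ha) ha' i j).1

theorem runs_algorithm :
    ∃ t, Runs algorithm (I.input Es) (result I Es) t ∧ t ≤ timeBound.eval (n + c) := by
  -- The number of communities moves to array `30`, and its old cell is cleared because array `1`
  -- receives the output matrix.
  have h1 := Runs.setNat 30 (.const 0) (.const 0) (.var 1) (I.input Es)
  simp only [NatExpr.eval, show (I.input Es).nat (1, 0, 0) = c from rfl] at h1
  have h2 := Runs.setNat 1 (.const 0) (.const 0) (.const 0)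
    { I.input Es with nat := Function.update (I.input Es).nat (30, 0, 0) c }
  have hs : ∀ b, (start I Es).nat (sizeArray b, 0, 0) ≤ n + c := by
    intro b
    rw [start_nat]
    cases b <;> simp [sizeArray, Instance.input]
  have hs' : ∀ b, (final (start I Es)).nat (sizeArray b, 0, 0) ≤ n + c := fun b => by
    rw [(final_frame (by cases b <;> simp [sizeArray]) 0 0).1]
    exact hs b
  obtain ⟨t, ht, htc⟩ := Command.exists_runs_compile (C := .block commands) rfl (start I Es) hs
  obtain ⟨u, hu, huc⟩ := Command.exists_runs_compile (C := outputEdges) rfl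
    (final (start I Es)) hs'
  have h3 : Runs (.branch (.pos 34 (.const 0) (.const 0))
      (.setNat 0 (.const 0) (.const 0) (.const 1)) (.setNat 0 (.const 0) (.const 0) (.const 0)))
      (outputEdges.run (final (start I Es))) (result I Es) 9 := by
    have h34 := output_frame (a := 34) (by norm_num) rfl (final (start I Es)) 0 0
    by_cases h : 1 ≤ (final (start I Es)).nat (34, 0, 0)
    · rw [result, if_pos h]
      refine .branchTrue ?_ (.setNat 0 (.const 0) (.const 0) (.const 1) _)
      simpa only [Test.holds_pos, NatExpr.eval, h34] using h
    · rw [result, if_neg h]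
      refine .branchFalse ?_ (.setNat 0 (.const 0) (.const 0) (.const 0) _)
      simpa only [Test.holds_pos, NatExpr.eval, h34] using h
  refine ⟨_, .seq h1 (.seq h2 (.seq ht (.seq hu h3))), ?_⟩
  simp only [timeBound, eval_add, NatExpr.time, eval_ofNat]
  omega

theorem result_zero : (result I Es).nat (0, 0, 0) =
    if 1 ≤ (final (start I Es)).nat (34, 0, 0) then 1 else 0 := by
  simp [result]

open Classical in
theorem result_one (u v : Fin n) : (result I Es).nat (1, u, v) =
    if 1 ≤ (final (start I Es)).nat (29, u, v) ∨ 1 ≤ (final (start I Es)).nat (6, u, v)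
      then 1 else 0 := by
  have h0 : (final (start I Es)).nat (1, u, v) = 0 := by
    rw [(final_frame (by norm_num) _ _).1, start_nat]
    by_cases h : (u : ℕ) = 0 ∧ (v : ℕ) = 0
    · simp [h]
    · rw [if_neg (by simpa using h), if_neg (by simp)]
      simp only [Instance.input]
      split <;> first | rfl | (simp_all; try omega)
  have h : (result I Es).nat (1, u, v) = (outputEdges.run (final (start I Es))).nat (1, u, v) := by
    simp [result]
  rw [h]
  have := run_mark (ks := [(10, false), (11, false)]) (t := edgeTest 10 11) (B := 1)
    (i := .var 10) (j := .var 11) (D := .skip) rfl (final (start I Es)) u v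
  rw [h0] at this
  refine this.trans (if_congr ?_ rfl rfl)
  change ExistsLoops _ _ (outputEdges.run (final (start I Es))) ↔ _
  simp only [ExistsLoops, Test.holds_pos, Test.holds_or, NatExpr.eval, Memory.upd_nat,
    Nat.reduceEqDiff, false_and, and_self, if_true, if_false, sizeArray, Bool.false_eq_true,
    OfNat.zero_ne_ofNat, output_frame (a := 0) (by norm_num) rfl,
    output_frame (a := 29) (by norm_num) rfl, output_frame (a := 6) (by norm_num) rfl,
    final_sizeFalse, exists_lt_iff_fin, Fin.val_inj]
  constructor
  · rintro ⟨_, _, h, rfl, rfl⟩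
    exact h
  · intro h
    exact ⟨u, v, h, rfl, rfl⟩

theorem result_correct (hEs : ∀ e ∈ Es, e ∈ I.graph.edgeSet) :
    (∃ E' : Finset (Sym2 (Fin n)), ReportsEdges (result I Es) E' ∧ I.IsSolution E' ∧ Es ⊆ E' ∧
        (E'.card : ℤ) ≤ I.ell ∧ ∑ e ∈ E', I.weight e ≤ I.b) ∨
      (ReportsFailure (result I Es) ∧
        ¬ ∃ E' : Finset (Sym2 (Fin n)), I.IsMinimumSolution E' ∧ I.IsFitting Es E') := by
  classical
  obtain ⟨lab, hlab, htied, hsound⟩ := exists_labels I Es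
  by_cases hfail : 1 ≤ (final (start I Es)).nat (28, 0, 0)
  · refine .inr ⟨?_, ?_⟩
    · rw [ReportsFailure, result_zero, if_neg]
      rw [final_ok]
      exact fun h => h.1 hfail
    · rintro ⟨E', hm, hf⟩
      -- A fitting solution would provide an admissible center for every class.
      obtain ⟨y, hy, -⟩ := exists_selected_subset hm hf hsound
      obtain ⟨i, hi⟩ := (final_failure I Es hlab).1 hfail
      exact hi _ (hy (lab i))
  · have hadm : ∀ l, ∃ x, ClassAdmissible I Es lab l x := by
      have h := mt (final_failure I Es hlab).2 hfail
      push Not at h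
      intro l
      by_cases hl : ∃ i, lab i = l
      · obtain ⟨i, rfl⟩ := hl
        exact h i
      -- For a label that does not occur any vertex will do; one exists because `l`, read as a
      -- community, has a class with an admissible center.
      · obtain ⟨x, -⟩ := h l
        exact ⟨x, fun i hi => absurd ⟨i, hi⟩ hl⟩
    choose z hz using fun l => exists_isBest (hadm l)
    have hz' : ∀ i, Admissible I Es i (z (lab i)) := fun i => (hz (lab i)).1 i rfl
    have hok := final_ok I Es
    rw [final_card I Es hlab hEs hz, final_total I Es hlab hEs hz] at hok
    by_cases h34 : 1 ≤ (final (start I Es)).nat (34, 0, 0)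
    · obtain ⟨-, hcard, hsum⟩ := hok.1 h34
      refine .inl ⟨selected I Es lab z, ⟨?_, fun u v => ?_⟩, ⟨fun e he =>
        mem_edgeSet_of_mem_selected hEs hz' he, fun i => ⟨_, mem_centers_selected hz' i⟩, hcard,
        hsum⟩, Finset.subset_union_left, hcard, hsum⟩
      · rw [result_zero, if_pos h34]
      · rw [result_one]
        exact if_congr (final_selected I Es hlab hz u v) rfl rfl
    · refine .inr ⟨by rw [ReportsFailure, result_zero, if_neg h34], ?_⟩
      rintro ⟨E', hm, hf⟩
      refine h34 (hok.2 ⟨hfail, selected_bounds hEs hm hf htied hsound (fun l => (hz l).1) ?_⟩)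
      intro l y hy
      rcases (hz l).2 y hy with h | h
      · exact h.le
      · exact h.1

end Correctness

end StarsNWS

end

theorem mainTheorem4 :
    ∃ (P : StarsNWS.Program) (p : ℕ[X]), ∀ (n c : ℕ) (I : StarsNWS.Instance n c)
      (Es : Finset (Sym2 (Fin n))), (∀ e ∈ Es, e ∈ I.graph.edgeSet) →
      ∃ (m : StarsNWS.Memory) (t : ℕ),
        StarsNWS.Runs P (I.input Es) m t ∧ t ≤ p.eval (n + c) ∧
        ((∃ E' : Finset (Sym2 (Fin n)),
            StarsNWS.ReportsEdges m E' ∧ I.IsSolution E' ∧ Es ⊆ E' ∧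
            (E'.card : ℤ) ≤ I.ell ∧ ∑ e ∈ E', I.weight e ≤ I.b) ∨
          (StarsNWS.ReportsFailure m ∧
            ¬ ∃ E' : Finset (Sym2 (Fin n)), I.IsMinimumSolution E' ∧ I.IsFitting Es E')) := by
  refine ⟨StarsNWS.algorithm, StarsNWS.timeBound, fun n c I Es hEs => ?_⟩
  obtain ⟨t, ht, htb⟩ := StarsNWS.runs_algorithm I Es
  exact ⟨StarsNWS.result I Es, t, ht, htb, StarsNWS.result_correct I Es hEs⟩
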